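/- Let $p\ge 1$, $\alpha\ge 1$ and $\zeta\in[1-p,1)$ be real numbers. Let $G=(V,E)$ be a connected, locally finite, simple undirected graph (finite or infinite) with graph distance $d$, open balls $B(x,r)=\{y\in V: d(x,y)<r\}$ and counting measure $\#$. A path is a sequence $\theta=[x_0,\dots,x_n]$ of vertices with $n\ge1$ and $\{x_{i},x_{i+1}\}\in E$ for all $0\le i<n$; it is also regarded as the set of its vertices. For a family $\Theta$ of paths put $$\mathrm{Mod}_p(\Theta)=\inf\Bigl\{\sum_{v\in V}\rho(v)^p \;:\; \rho\colon V\to[0,\infty),\ \sum_{v\in\theta}\rho(v)\ge 1\text{ for all }\theta\in\Theta\Bigr\}\in[0,\infty].$$ Assume the following two conditions. * $\mathrm{VD}(\alpha)$: there is $C_{\mathrm D}\ge1$ such that $\dfrac{\#B(x,R)}{\#B(y,r)}\le C_{\mathrm D}^2\Bigl(\dfrac{d(x,y)+R}{r}\Bigr)^{\alpha}$ for all $x,y\in V$ and $1\le r\le R<\infty$. (Since $\#B(x,2)=\deg(x)+1$ and $\#B(x,1)=1$, this forces the degrees to be bounded by a constant depending only on $C_{\mathrm D}$ and $\alpha$.)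 * $\mathrm{BCL}_p(\zeta)$: there is $A\ge1$, and for every $\kappa>0$ there are $c(\kappa)>0$ and $L(\kappa)>0$, such that $$\mathrm{Mod}_p\bigl(\{\theta : \theta\text{ is a path from a vertex of }B_1\text{ to a vertex of }B_2,\ \mathrm{diam}\,\theta\le L(\kappa)R\}\bigr)\ge c(\kappa)R^{\zeta}$$ whenever $1\le R<\mathrm{diam}(G)/A$ and $B_1,B_2$ are balls of radius $R$ with $\mathrm{dist}(B_1,B_2)\le\kappa R$. Then $G$ satisfies the $(p,p)$-Poincaré inequality of order $\beta=\alpha-\zeta$ with $A_{\mathrm{PI}}=2$: there is a constant $C_{\mathrm{PI}}\ge 1$, depending only on $p,\alpha,\zeta,C_{\mathrm D},A$ and the functions $c(\cdot),L(\cdot)$ (and not otherwise on $G$), such that for all $x\in V$, $R\ge1$ and $f\colon V\to\mathbb R$, $$\sum_{y\in B(x,R)}\bigl|f(y)-f_{B(x,R)}\bigr|^p\le C_{\mathrm{PI}}\,R^{\alpha-\zeta}\sum_{\substack{\{y,z\}\in E\\ y,z\in B(x,2R)}}|f(y)-f(z)|^p,\qquad f_{B(x,R)}=\frac1{\#B(x,R)}\sum_{y\in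 B(x,R)}f(y).$$ -/

import Mathlib

open scoped ENNReal NNReal

universe u

noncomputable section

namespace DiscretePI

variable {V : Type u}

/-- The open ball `B(x, r) = {y | d(x, y) < r}` for the graph distance. (Everything below is
applied to connected graphs, for which `SimpleGraph.dist` is the graph metric.) -/
def ball (G : SimpleGraph V) (x : V) (r : ℝ) : Set V :=
  {y | (G.dist x y : ℝ) < r}

/-- The distance `dist(S, T) = inf {d(x, y) | x ∈ S, y ∈ T}` between two nonempty sets of
vertices. -/
def setDist (G : SimpleGraph V) (S T : Set V) : ℕ :=
  sInf {n : ℕ | ∃ x ∈ S, ∃ y ∈ T, G.dist x y = n}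

/-- A finite path `[x₀, …, xₙ]` with `n ≥ 1` and `{xᵢ, xᵢ₊₁} ∈ E` for all `i < n`; vertices may
repeat. -/
structure FinPath (G : SimpleGraph V) where
  /-- the first vertex `x₀` -/
  first : V
  /-- the last vertex `xₙ` -/
  last : V
  /-- the sequence of vertices -/
  walk : G.Walk first last
  /-- one-point sequences are not paths -/
  length_pos : 0 < walk.length

open Classical in
/-- The path regarded as a set of vertices. -/
def FinPath.verts {G : SimpleGraph V} (θ : FinPath G) : Finset V :=
  θ.walk.support.toFinset

/-- The diameter, in the graph metric, of a path regarded as a set of vertices. -/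
def FinPath.diam {G : SimpleGraph V} (θ : FinPath G) : ℕ :=
  (θ.verts ×ˢ θ.verts).sup fun q => G.dist q.1 q.2

/-- `Path(A₀, A₁)`: the finite paths that start in `A₀` and end in `A₁`. -/
def pathsBetween (G : SimpleGraph V) (A₀ A₁ : Set V) : Set (FinPath G) :=
  {θ | θ.first ∈ A₀ ∧ θ.last ∈ A₁}

/-- The `ρ`-length `L_ρ(θ) = ∑_{v ∈ θ} ρ(v)` of a path. -/
def rhoLength {G : SimpleGraph V} (ρ : V → ℝ≥0) (θ : FinPath G) : ℝ≥0 :=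
  ∑ v ∈ θ.verts, ρ v

/-- The `ρ`-length `L_ρ(Θ) = inf_{θ ∈ Θ} L_ρ(θ)` of a family of paths; it is `∞` for the empty
family. -/
def rhoLengthFamily {G : SimpleGraph V} (ρ : V → ℝ≥0) (Θ : Set (FinPath G)) : ℝ≥0∞ :=
  ⨅ θ ∈ Θ, (rhoLength ρ θ : ℝ≥0∞)

/-- The admissible functions of a family of paths. -/
def Adm {G : SimpleGraph V} (Θ : Set (FinPath G)) : Set (V → ℝ≥0) :=
  {ρ | 1 ≤ rhoLengthFamily ρ Θ}

/-- The combinatorial `p`-modulus `Mod_p(Θ) = inf_{ρ ∈ Adm(Θ)} ∑_{v ∈ V} ρ(v)^p`. -/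
def modulus {G : SimpleGraph V} (p : ℝ) (Θ : Set (FinPath G)) : ℝ≥0∞ :=
  ⨅ ρ ∈ Adm Θ, ∑' v : V, (ρ v : ℝ≥0∞) ^ p

/-- The length of the discrete gradient, `|∇f|({x, y}) = |f(y) - f(x)|`. -/
def gradLength (f : V → ℝ) : Sym2 V → ℝ :=
  Sym2.lift ⟨fun x y => |f y - f x|, fun x y => abs_sub_comm (f y) (f x)⟩

/-- `E(A)`: the edges with both endpoints in `A`. -/
def edgesIn (G : SimpleGraph V) (A : Set V) : Set (Sym2 V) :=
  {e | e ∈ G.edgeSet ∧ ∀ v ∈ e, v ∈ A}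

/-- The `p`-energy `∑_{{x, y} ∈ E(A)} |f(x) - f(y)|^p` of `f` on `A`; each edge counts once. -/
def energy (G : SimpleGraph V) (p : ℝ) (A : Set V) (f : V → ℝ) : ℝ≥0∞ :=
  ∑' e : edgesIn G A, ENNReal.ofReal (gradLength f e ^ p)

/-- The average `f_A` of `f` over a finite nonempty set `A` for the counting measure. -/
def average (A : Set V) (f : V → ℝ) : ℝ :=
  (∑ᶠ y ∈ A, f y) / (A.ncard : ℝ)

/-- The volume growth condition `VD(α)` with constant `C_D`, for the graph distance and the
counting measure. -/
def VDGrowth (G : SimpleGraph V) (α CD : ℝ) : Prop :=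
  1 ≤ CD ∧ ∀ (x y : V) (r R : ℝ), 1 ≤ r → r ≤ R →
    ((ball G x R).ncard : ℝ) / ((ball G y r).ncard : ℝ)
      ≤ CD ^ 2 * (((G.dist x y : ℝ) + R) / r) ^ α

/-- The `p`-combinatorial ball Loewner condition with exponent `ζ`, with constants `A`, `c(κ)`,
`L(κ)`. The diameter of the graph may be infinite. -/
def BallLoewner (G : SimpleGraph V) (p ζ A : ℝ) (c L : ℝ → ℝ) : Prop :=
  1 ≤ A ∧ ∀ κ : ℝ, 0 < κ → 0 < c κ ∧ 0 < L κ ∧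
    ∀ (R : ℝ) (x₁ x₂ : V), 1 ≤ R →
      ENNReal.ofReal R < (G.ediam : ℝ≥0∞) / ENNReal.ofReal A →
      (setDist G (ball G x₁ R) (ball G x₂ R) : ℝ) ≤ κ * R →
      ENNReal.ofReal (c κ * R ^ ζ) ≤
        modulus p {θ | θ ∈ pathsBetween G (ball G x₁ R) (ball G x₂ R) ∧
          (θ.diam : ℝ) ≤ L κ * R}

/-- The `(p, p)`-Poincaré inequality of order `β` with constants `C_PI` and `A_PI`. -/
def Poincare (G : SimpleGraph V) (p β CPI API : ℝ) : Prop :=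
  1 ≤ CPI ∧ 1 ≤ API ∧ ∀ (x : V) (R : ℝ) (f : V → ℝ), 1 ≤ R →
    ENNReal.ofReal (∑ᶠ y ∈ ball G x R, |f y - average (ball G x R) f| ^ p)
      ≤ ENNReal.ofReal (CPI * R ^ β) * energy G p (ball G x (API * R)) f

end DiscretePI

end

/-! Let `ρ v` be the `ℓ^p`-norm of the differences of `f` along the edges at `v`. It dominates every
one of these differences, and its `p`-energy is at most twice the edge energy. If all Loewner paths
between two nearby balls of radius `r` had `ρ`-length above a suitable `T`, then `ρ / T` would be
admissible with mass below the modulus. So some path joins the balls with oscillation of `f` at most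
a constant times `(W / r ^ ζ) ^ (1 / p)`, `W` being the energy in a comparable ball
(`BallLoewner.exists_path`, `HasJumps`).

Two such paths need not meet, so values on them must be compared: this is the core,
`exists_abs_sub_le_of_walkConnected`. Let `H = 32 * N`. A connected set of diameter at least `H ^ (k
+ 1)` runs through `N` disjoint balls of radius `16 * H ^ k`, one of which has at most `1 / N` of
the energy. Choose such a ball on each set, join the two by a Loewner path, and recurse on each set
against that path. The two subproblems live one scale lower, where the error bound is smaller by the
factor `η / τ`, with `τ = N ^ (1 / p)` and `η = H ^ (ζ / p)`. Since `ζ < 1`, some `N` gives `τ ≥ 4 *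
η`, which pays for both subproblems and the jump.

Next, `a k x` is the value of `f` at a point within `H ^ k` of `x` on a Loewner path of that scale.
Then `a 0 = f`, and values at consecutive scales or nearby points differ by a multiple of local
energies to the power `1 / p`, divided by `η ^ k`. Telescope up to `H ^ n` comparable to `R`, then
chain across the ball in boundedly many steps. In the sum of `p`-th powers, volume growth bounds the
overlap at scale `k` by a multiple of `H ^ (k * α)`, and the series, geometric with exponent `α - ζ
> 0`, gives `R ^ (α - ζ)`. -/

noncomputable section

namespace DiscretePI

variable {V : Type u} {G : SimpleGraph V}

/-! ### Graph distance, connected sets and finite balls -/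

/-- Discrete intermediate value theorem along a walk. -/
lemma exists_mem_support_eq (φ : V → ℕ) (hφ : ∀ u v, G.Adj u v → φ v ≤ φ u + 1) {a b : V}
    (w : G.Walk a b) {n : ℕ} (ha : φ a ≤ n) (hb : n ≤ φ b) : ∃ x ∈ w.support, φ x = n := by
  induction w with
  | nil => exact ⟨_, by simp, le_antisymm ha hb⟩
  | @cons a c b h w ih =>
    rcases ha.eq_or_lt with h1 | h1
    · exact ⟨a, by simp, h1⟩
    · obtain ⟨x, hx, hx'⟩ := ih ((hφ _ _ h).trans h1) hb
      exact ⟨x, by simp [hx], hx'⟩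

lemma dist_le_dist_add_one (hG : G.Connected) (e u v : V) (h : G.Adj u v) :
    G.dist e v ≤ G.dist e u + 1 := by
  have := hG.dist_triangle (u := e) (v := u) (w := v)
  rwa [SimpleGraph.dist_eq_one_iff_adj.2 h] at this

/-- A set of vertices any two points of which are joined by a walk inside the set. -/
def WalkConnected (G : SimpleGraph V) (S : Set V) : Prop :=
  ∀ u ∈ S, ∀ v ∈ S, ∃ w : G.Walk u v, ∀ x ∈ w.support, x ∈ S

lemma WalkConnected.exists_dist_eq (hG : G.Connected) {S : Set V} (hS : WalkConnected G S)
    {e e' : V} (he : e ∈ S) (he' : e' ∈ S) {n : ℕ} (hn : n ≤ G.dist e e') :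
    ∃ x ∈ S, G.dist e x = n := by
  obtain ⟨w, hw⟩ := hS e he e' he'
  obtain ⟨x, hx, hx'⟩ := exists_mem_support_eq (G.dist e) (dist_le_dist_add_one hG e) w
    (n := n) (by simp) hn
  exact ⟨x, hw x hx, hx'⟩

lemma exists_dist_eq_of_le (hG : G.Connected) {x y : V} {n : ℕ} (hn : n ≤ G.dist x y) :
    ∃ z, G.dist x z = n ∧ G.dist z y + n = G.dist x y := by
  obtain ⟨w, hw⟩ := hG.exists_walk_length_eq_dist x y
  obtain ⟨z, hz, hz'⟩ := exists_mem_support_eq (G.dist x) (dist_le_dist_add_one hG x) w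
    (n := n) (by simp) hn
  refine ⟨z, hz', ?_⟩
  classical
  have h1 := congrArg SimpleGraph.Walk.length (w.take_spec hz)
  rw [SimpleGraph.Walk.length_append, hw] at h1
  have h2 := SimpleGraph.dist_le (w.takeUntil z hz)
  have h3 := SimpleGraph.dist_le (w.dropUntil z hz)
  have h4 := hG.dist_triangle (u := x) (v := z) (w := y)
  omega

lemma finite_ball (hG : G.Connected) (hf : ∀ v : V, (G.neighborSet v).Finite) (x : V) (r : ℝ) :
    (ball G x r).Finite := by
  have key : ∀ n : ℕ, {y | G.dist x y ≤ n}.Finite := by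
    intro n
    induction n with
    | zero =>
      refine (Set.finite_singleton x).subset fun y hy => ?_
      have : G.dist x y = 0 := by simpa using hy
      exact ((hG.dist_eq_zero_iff).1 this).symm
    | succ n ih =>
      refine (ih.union (ih.biUnion fun z _ => hf z)).subset fun y hy => ?_
      rcases Nat.lt_or_ge n (G.dist x y) with h | h
      · right
        obtain ⟨z, hz, hz'⟩ := exists_dist_eq_of_le hG h.le
        have hy' : G.dist x y ≤ n + 1 := hy
        have : G.dist z y = 1 := by omega
        exact Set.mem_biUnion (x := z) hz.le (SimpleGraph.dist_eq_one_iff_adj.1 this)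
      · exact Or.inl h
  refine (key ⌈r⌉₊).subset fun y hy => ?_
  have : (G.dist x y : ℝ) ≤ ⌈r⌉₊ := (le_of_lt hy).trans (Nat.le_ceil r)
  exact_mod_cast this

/-! ### Oscillation of `f` along walks and paths -/

variable {f ρ : V → ℝ} {b : V → ℕ → Finset V}

lemma abs_sub_le_sum_support (hρ0 : ∀ v, 0 ≤ ρ v) (hρ : ∀ v w, G.Adj v w → |f v - f w| ≤ ρ v)
    {a b : V} (w : G.Walk a b) : |f a - f b| ≤ (w.support.map ρ).sum := by
  induction w with
  | nil => simpa using hρ0 _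
  | @cons a c b h w ih =>
    have := abs_sub_le (f a) (f c) (f b)
    have := hρ _ _ h
    simp only [SimpleGraph.Walk.support_cons, List.map_cons, List.sum_cons]
    linarith

lemma abs_sub_le_length_mul (hρ : ∀ v w, G.Adj v w → |f v - f w| ≤ ρ v) {B : ℝ}
    {a b : V} (w : G.Walk a b) (hB : ∀ v ∈ w.support, ρ v ≤ B) :
    |f a - f b| ≤ w.length * B := by
  induction w with
  | nil => simp
  | @cons a c b h w ih =>
    have h1 := abs_sub_le (f a) (f c) (f b)
    have h2 := hρ _ _ h
    have h3 := hB a (by simp)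
    have h4 := ih fun v hv => hB v (by simp [hv])
    simp only [SimpleGraph.Walk.length_cons]
    push_cast
    linarith

lemma abs_sub_le_dist_mul (hG : G.Connected) (hρ : ∀ v w, G.Adj v w → |f v - f w| ≤ ρ v) {B : ℝ}
    {a b : V} (hB : ∀ v, G.dist a v ≤ G.dist a b → ρ v ≤ B) :
    |f a - f b| ≤ G.dist a b * B := by
  classical
  obtain ⟨w, hw⟩ := hG.exists_walk_length_eq_dist a b
  rw [← hw]
  refine abs_sub_le_length_mul hρ w fun v hv => hB v ?_
  rw [← hw]
  exact (SimpleGraph.dist_le (w.takeUntil v hv)).trans (w.length_takeUntil_le_length hv)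

lemma FinPath.mem_verts {θ : FinPath G} {v : V} : v ∈ θ.verts ↔ v ∈ θ.walk.support := by
  classical
  simp [FinPath.verts]

lemma FinPath.first_mem (θ : FinPath G) : θ.first ∈ θ.verts := by
  simp [FinPath.mem_verts]

lemma FinPath.last_mem (θ : FinPath G) : θ.last ∈ θ.verts := by
  simp [FinPath.mem_verts]

lemma FinPath.walkConnected (θ : FinPath G) : WalkConnected G (θ.verts : Set V) := by
  classical
  intro u hu v hv
  have hu' := FinPath.mem_verts.1 (Finset.mem_coe.1 hu)
  have hv' := FinPath.mem_verts.1 (Finset.mem_coe.1 hv)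
  refine ⟨(θ.walk.takeUntil u hu').reverse.append (θ.walk.takeUntil v hv'), fun x hx => ?_⟩
  rw [Finset.mem_coe, FinPath.mem_verts]
  rw [SimpleGraph.Walk.mem_support_append_iff, SimpleGraph.Walk.support_reverse,
    List.mem_reverse] at hx
  rcases hx with hx | hx
  · exact θ.walk.support_takeUntil_subset_support _ hx
  · exact θ.walk.support_takeUntil_subset_support _ hx

lemma FinPath.dist_le_diam (θ : FinPath G) {u v : V} (hu : u ∈ θ.verts) (hv : v ∈ θ.verts) :
    G.dist u v ≤ θ.diam :=
  Finset.le_sup (f := fun q : V × V => G.dist q.1 q.2) (b := (u, v))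
    (Finset.mem_product.2 ⟨hu, hv⟩)

lemma FinPath.abs_sub_le_sum (hρ0 : ∀ v, 0 ≤ ρ v) (hρ : ∀ v w, G.Adj v w → |f v - f w| ≤ ρ v)
    (θ : FinPath G) {u v : V} (hu : u ∈ θ.verts) (hv : v ∈ θ.verts) :
    |f u - f v| ≤ ∑ x ∈ θ.verts, ρ x := by
  classical
  obtain ⟨w, hw⟩ := θ.walkConnected u hu v hv
  -- The `ρ`-length counts each vertex once, so repetitions are removed before summing.
  refine (abs_sub_le_sum_support hρ0 hρ w.bypass).trans ?_
  rw [← List.sum_toFinset ρ (w.bypass_isPath.support_nodup)]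
  refine Finset.sum_le_sum_of_subset_of_nonneg (fun x hx => ?_) fun x _ _ => hρ0 x
  exact hw x (w.support_bypass_subset_support (List.mem_toFinset.1 hx))

/-! ### From modulus bounds to paths of small `ρ`-length -/

/-- All paths stay in `s`, so `ρ` cut off outside `s` remains admissible and has finite mass. -/
lemma modulus_le_of_sum_le {p : ℝ} (hp : 1 ≤ p) {Θ : Set (FinPath G)} (hρ0 : ∀ v, 0 ≤ ρ v)
    {s : Finset V} (hs : ∀ θ ∈ Θ, θ.verts ⊆ s) (h : ∀ θ ∈ Θ, 1 ≤ ∑ v ∈ θ.verts, ρ v) :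
    modulus p Θ ≤ ENNReal.ofReal (∑ v ∈ s, ρ v ^ p) := by
  classical
  set ρ' : V → ℝ≥0 := fun v => if v ∈ s then (ρ v).toNNReal else 0 with hρ'
  have hadm : ρ' ∈ Adm Θ := by
    change 1 ≤ rhoLengthFamily ρ' Θ
    refine le_iInf₂ fun θ hθ => ?_
    rw [ENNReal.one_le_coe_iff, ← NNReal.coe_le_coe, rhoLength, NNReal.coe_sum]
    refine (h θ hθ).trans (Finset.sum_le_sum fun v hv => ?_)
    simp [hρ', hs θ hθ hv, hρ0 v]
  refine (iInf₂_le ρ' hadm).trans (le_of_eq ?_)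
  rw [tsum_eq_sum (s := s) fun v hv => by
    simp only [hρ', hv, if_false, ENNReal.coe_zero]
    exact ENNReal.zero_rpow_of_pos (by linarith),
    ENNReal.ofReal_sum_of_nonneg fun v _ => Real.rpow_nonneg (hρ0 v) p]
  refine Finset.sum_congr rfl fun v hv => ?_
  rw [← ENNReal.ofReal_rpow_of_nonneg (hρ0 v) (by linarith)]
  simp [hρ', hv, ENNReal.ofReal]

lemma ofReal_lt_ediam_div {A r : ℝ} (hG : G.Connected) (hA : 0 < A) (hr : 0 ≤ r) {u v : V}
    (h : A * r < G.dist u v) : ENNReal.ofReal r < (G.ediam : ℝ≥0∞) / ENNReal.ofReal A := by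
  rw [ENNReal.lt_div_iff_mul_lt (by left; simpa using hA) (by simp),
    ← ENNReal.ofReal_mul' hA.le]
  have h1 : ((G.dist u v : ℕ) : ℝ≥0∞) ≤ (G.ediam : ℝ≥0∞) := by
    have h2 : ((G.dist u v : ℕ) : ℕ∞) ≤ G.ediam := by
      rw [SimpleGraph.dist, ENat.natCast_toNat (SimpleGraph.edist_ne_top_iff_reachable.2 (hG u v))]
      exact SimpleGraph.edist_le_ediam
    exact_mod_cast h2
  refine lt_of_lt_of_le ?_ h1
  rw [← ENNReal.ofReal_natCast]
  rw [mul_comm r A]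
  exact (ENNReal.ofReal_lt_ofReal_iff (lt_of_le_of_lt (by positivity) h)).2 h

/-- The ball Loewner condition gives short paths between nearby balls of equal radius. -/
lemma BallLoewner.exists_path {p ζ A : ℝ} {c L : ℝ → ℝ} (hp : 1 ≤ p)
    (hBL : BallLoewner G p ζ A c L) (hG : G.Connected)
    {b : V → ℕ → Finset V} (hb : ∀ x n v, v ∈ b x n ↔ G.dist x v < n) (hρ0 : ∀ v, 0 ≤ ρ v)
    {κ : ℝ} (hκ : 0 < κ) {n m : ℕ} (hn : 1 ≤ n) {x₁ x₂ u v : V} (hd : (G.dist x₁ x₂ : ℝ) ≤ κ * n)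
    (hA : A * n < G.dist u v) (hm : (L κ + 1) * n ≤ m) :
    ∃ θ : FinPath G, G.dist x₁ θ.first < n ∧ G.dist x₂ θ.last < n ∧ θ.verts ⊆ b x₁ m ∧
      ∑ x ∈ θ.verts, ρ x ≤ (2 * (∑ x ∈ b x₁ m, ρ x ^ p) / (c κ * (n : ℝ) ^ ζ)) ^ (1 / p) := by
  have hp0 : 0 < p := by linarith
  have hn0 : (0 : ℝ) < n := by exact_mod_cast hn
  obtain ⟨hA1, hBL⟩ := hBL
  obtain ⟨hc, hL, hBL⟩ := hBL κ hκ
  have hdist : (setDist G (ball G x₁ n) (ball G x₂ n) : ℝ) ≤ κ * n := by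
    refine le_trans ?_ hd
    have : setDist G (ball G x₁ n) (ball G x₂ n) ≤ G.dist x₁ x₂ :=
      Nat.sInf_le ⟨x₁, by simp [ball]; omega, x₂, by simp [ball]; omega, rfl⟩
    exact_mod_cast this
  have hmod := hBL n x₁ x₂ (by exact_mod_cast hn) (ofReal_lt_ediam_div hG (by linarith) hn0.le hA) hdist
  set W := ∑ x ∈ b x₁ m, ρ x ^ p with hW
  have hW0 : 0 ≤ W := Finset.sum_nonneg fun x _ => Real.rpow_nonneg (hρ0 x) p
  have hcn : 0 < c κ * (n : ℝ) ^ ζ := mul_pos hc (Real.rpow_pos_of_pos hn0 _)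
  set T := (2 * W / (c κ * (n : ℝ) ^ ζ)) ^ (1 / p) with hT
  have hT0 : 0 ≤ T := Real.rpow_nonneg (by positivity) _
  have hTp : T ^ p = 2 * W / (c κ * (n : ℝ) ^ ζ) := by
    rw [hT, ← Real.rpow_mul (by positivity), one_div_mul_cancel hp0.ne', Real.rpow_one]
  -- Otherwise `ρ / T` is admissible; the factor 2 in `T` keeps its mass at most half of the lower
  -- bound for the modulus.
  by_contra! hcon
  set Θ := {θ : FinPath G | θ ∈ pathsBetween G (ball G x₁ n) (ball G x₂ n) ∧
          (θ.diam : ℝ) ≤ L κ * n} with hΘ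
  have hsub : ∀ θ ∈ Θ, θ.verts ⊆ b x₁ m := by
    rintro θ ⟨⟨h1, h2⟩, h3⟩ v hv
    rw [hb]
    have h4 := hG.dist_triangle (u := x₁) (v := θ.first) (w := v)
    have h5 := θ.dist_le_diam θ.first_mem hv
    have h6 : (G.dist x₁ θ.first : ℝ) < n := h1
    have h4' : (G.dist x₁ v : ℝ) ≤ G.dist x₁ θ.first + G.dist θ.first v := by exact_mod_cast h4
    have h5' : (G.dist θ.first v : ℝ) ≤ θ.diam := by exact_mod_cast h5
    have : (G.dist x₁ v : ℝ) < m := by linarith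
    exact_mod_cast this
  have hlt : ∀ θ ∈ Θ, T < ∑ x ∈ θ.verts, ρ x := by
    intro θ hθ
    have h1 : (G.dist x₁ θ.first : ℝ) < n := hθ.1.1
    have h2 : (G.dist x₂ θ.last : ℝ) < n := hθ.1.2
    exact hcon θ (by exact_mod_cast h1) (by exact_mod_cast h2) (hsub θ hθ)
  have hone : ∀ θ ∈ Θ, 1 ≤ ∑ v ∈ θ.verts, ρ v / T := by
    intro θ hθ
    rw [← Finset.sum_div]
    rcases hT0.eq_or_lt with h0 | h0
    -- If `T = 0`, the energy vanishes, so `ρ = 0` along every path of the family, against `hlt`.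
    · exfalso
      have hW' : W = 0 := by
        rw [← h0, Real.zero_rpow hp0.ne', eq_comm, div_eq_zero_iff] at hTp
        rcases hTp with h | h
        · linarith
        · exact absurd h hcn.ne'
      have h1 := hlt θ hθ
      rw [Finset.sum_eq_zero, ← h0] at h1
      · exact lt_irrefl _ h1
      · intro x hx
        have := (Finset.sum_eq_zero_iff_of_nonneg
          fun x _ => Real.rpow_nonneg (hρ0 x) p).1 (hW.symm.trans hW') x (hsub θ hθ hx)
        exact ((Real.rpow_eq_zero_iff_of_nonneg (hρ0 x)).1 this).1
    · rw [one_le_div h0]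
      exact (hlt θ hθ).le
  have h1 := hmod.trans (modulus_le_of_sum_le hp (fun v => div_nonneg (hρ0 v) hT0) hsub hone)
  have h2 : ∑ v ∈ b x₁ m, (ρ v / T) ^ p = W / T ^ p := by
    rw [hW, Finset.sum_div]
    exact Finset.sum_congr rfl fun v _ => Real.div_rpow (hρ0 v) hT0 p
  have h3 : W / T ^ p ≤ c κ * (n : ℝ) ^ ζ / 2 := by
    rw [hTp]
    rcases hW0.eq_or_lt with h0 | h0
    · rw [← h0]; simp; positivity
    · apply le_of_eq; field_simp
  rw [h2, ENNReal.ofReal_le_ofReal_iff (div_nonneg hW0 (Real.rpow_nonneg hT0 p))] at h1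
  linarith

/-! ### Comparing `f` on two connected sets by induction on scales -/

lemma sum_ball_le (hG : G.Connected) (hb : ∀ x n v, v ∈ b x n ↔ G.dist x v < n)
    {g : V → ℝ} (hg : ∀ v, 0 ≤ g v) {x y : V} {m n : ℕ} (h : G.dist x y + m ≤ n) :
    ∑ v ∈ b y m, g v ≤ ∑ v ∈ b x n, g v := by
  refine Finset.sum_le_sum_of_subset_of_nonneg (fun v hv => ?_) fun v _ _ => hg v
  rw [hb] at hv ⊢
  have := hG.dist_triangle (u := x) (v := y) (w := v)
  omega

/-- A connected set of large diameter contains a point around which a weight is small. -/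
lemma exists_sum_ball_le (hG : G.Connected) (hb : ∀ x n v, v ∈ b x n ↔ G.dist x v < n)
    {g : V → ℝ} (hg : ∀ v, 0 ≤ g v) {E : Set V} (hE : WalkConnected G E) {e e' z : V}
    (he : e ∈ E) (he' : e' ∈ E) {N n : ℕ} (hN : 1 ≤ N)
    (hd : 32 * N * n ≤ G.dist e e') (hz : G.dist z e ≤ 3 * (32 * N * n)) {X : ℝ}
    (hX : ∑ v ∈ b z (16 * (32 * N * n)), g v ≤ N * X) :
    ∃ x ∈ E, G.dist e x ≤ 32 * N * n ∧ n ≤ G.dist e x ∧ ∑ v ∈ b x (16 * n), g v ≤ X := by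
  classical
  -- Centres on `E` at distances `32 * (j + 1) * n` from `e`: the spacing makes balls of radius `16
  -- * n` disjoint, and the average over the `N` balls selects one.
  have hex : ∀ j : ℕ, ∃ x, j < N → x ∈ E ∧ G.dist e x = 32 * (j + 1) * n := by
    intro j
    by_cases hj : j < N
    · have : 32 * (j + 1) * n ≤ G.dist e e' :=
        le_trans (Nat.mul_le_mul_right _ (by omega)) hd
      obtain ⟨x, hx, hx'⟩ := hE.exists_dist_eq hG he he' this
      exact ⟨x, fun _ => ⟨hx, hx'⟩⟩
    · exact ⟨e, fun h => absurd h hj⟩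
  choose x hx using hex
  have hle : ∀ j < N, 32 * (j + 1) * n ≤ 32 * N * n := fun j hj =>
    Nat.mul_le_mul_right _ (by omega)
  have hdisj : ∀ i < N, ∀ j < N, i < j → Disjoint (b (x i) (16 * n)) (b (x j) (16 * n)) := by
    intro i hi j hj hij
    rw [Finset.disjoint_left]
    intro v hv hv'
    rw [hb] at hv hv'
    have h1 := hG.dist_triangle (u := e) (v := x i) (w := v)
    have h2 := hG.dist_triangle (u := e) (v := v) (w := x j)
    rw [G.dist_comm (u := v)] at h2
    have h3 := (hx i hi).2
    have h4 := (hx j hj).2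
    have h5 : 32 * (i + 1) * n + 32 * n ≤ 32 * (j + 1) * n := by
      rw [← add_mul]
      exact Nat.mul_le_mul_right _ (by omega)
    omega
  have hsum : ∑ j ∈ Finset.range N, ∑ v ∈ b (x j) (16 * n), g v ≤ ∑ _j ∈ Finset.range N, X := by
    rw [← Finset.sum_biUnion]
    · rw [Finset.sum_const, Finset.card_range, nsmul_eq_mul]
      refine le_trans (Finset.sum_le_sum_of_subset_of_nonneg (fun v hv => ?_) fun v _ _ => hg v) hX
      obtain ⟨j, hj, hv⟩ := Finset.mem_biUnion.1 hv
      rw [Finset.mem_range] at hj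
      rw [hb] at hv ⊢
      have h1 := hG.dist_triangle (u := z) (v := e) (w := v)
      have h2 := hG.dist_triangle (u := e) (v := x j) (w := v)
      have h3 := (hx j hj).2
      have h4 := hle j hj
      have h5 : n ≤ 32 * N * n := Nat.le_mul_of_pos_left _ (by omega)
      have h6 : 32 * n ≤ 32 * N * n := Nat.mul_le_mul_right _ (by omega)
      omega
    · intro i hi j hj hij
      rw [Finset.mem_coe, Finset.mem_range] at hi hj
      rcases lt_or_gt_of_ne hij with h | h
      · exact hdisj i hi j hj h
      · exact (hdisj j hj i hi h).symm
  obtain ⟨j, hj, hj'⟩ := Finset.exists_le_of_sum_le (by simpa using by omega) hsum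
  rw [Finset.mem_range] at hj
  refine ⟨x j, (hx j hj).1, (hx j hj).2 ▸ hle j hj, ?_, hj'⟩
  rw [(hx j hj).2]
  exact Nat.le_mul_of_pos_left _ (by omega)

/-- Balls of radius `H ^ k` at distance at most `5 * H ^ (k + 1)` can be joined by a connected set
on which the oscillation of `f` is controlled by the `p`-energy of `ρ`. -/
def HasJumps (G : SimpleGraph V) (f ρ : V → ℝ) (b : V → ℕ → Finset V) (p : ℝ) (H l : ℕ)
    (J η : ℝ) : Prop :=
  ∀ (k : ℕ) (x₁ x₂ u v : V) (X : ℝ), G.dist x₁ x₂ ≤ 5 * H ^ (k + 1) →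
    H ^ (k + 1) ≤ G.dist u v → 0 ≤ X → ∑ v ∈ b x₁ (H ^ (k + 1 + l)), ρ v ^ p ≤ X ^ p →
    ∃ S : Set V, WalkConnected G S ∧ (∃ g ∈ S, G.dist x₁ g < H ^ k) ∧
      (∃ h ∈ S, G.dist x₂ h < H ^ k) ∧ ∀ u ∈ S, ∀ v ∈ S, |f u - f v| ≤ J * X / η ^ k

/-- Two connected sets of large diameter and small distance contain points at which the values of
`f` are close, in terms of the `p`-energy. -/
theorem exists_abs_sub_le_of_walkConnected (hG : G.Connected)
    (hb : ∀ x n v, v ∈ b x n ↔ G.dist x v < n) (hρ0 : ∀ v, 0 ≤ ρ v)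
    (hρ : ∀ v w, G.Adj v w → |f v - f w| ≤ ρ v) {p : ℝ} (hp : 1 ≤ p) {N l : ℕ} (hN : 1 ≤ N)
    {J η τ K : ℝ} (hJ : HasJumps G f ρ b p (32 * N) l J η) (hη : 0 < η) (hτ : 0 < τ)
    (hτN : τ ^ p = N) (hτη : 4 * η ≤ τ) (hK : 3 ≤ K) (hKJ : J * τ ^ (l + 1) ≤ 2 * K) (k : ℕ) :
    ∀ (E F : Set V) (e e' z z' : V) (B : ℝ), WalkConnected G E → WalkConnected G F →
      e ∈ E → e' ∈ E → z ∈ F → z' ∈ F → (32 * N) ^ k ≤ G.dist e e' → (32 * N) ^ k ≤ G.dist z z' →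
      G.dist e z ≤ 3 * (32 * N) ^ k → 0 ≤ B →
      (∀ j, k ≤ j → j ≤ k + l →
        ∑ v ∈ b e (8 * ((32 * N) ^ j + (32 * N) ^ k)), ρ v ^ p ≤ (B * τ ^ j) ^ p) →
      ∃ u ∈ E, ∃ v ∈ F, |f u - f v| ≤ K * B * (τ / η) ^ k := by
  have hp0 : 0 < p := by linarith
  have hg : ∀ v, 0 ≤ ρ v ^ p := fun v => Real.rpow_nonneg (hρ0 v) p
  set H := 32 * N with hH
  induction k with
  | zero =>
    intro E F e e' z z' B hE hF he he' hz hz' hd hd' hez hB hW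
    refine ⟨e, he, z, hz, ?_⟩
    simp only [pow_zero, mul_one] at hez ⊢
    have h1 := hW 0 le_rfl (by omega)
    simp only [pow_zero, mul_one] at h1
    -- At unit scale the energy bound gives `ρ ≤ B` near `e`, and a geodesic has at most 3 edges;
    -- hence `3 ≤ K`.
    have h2 : |f e - f z| ≤ G.dist e z * B := by
      refine abs_sub_le_dist_mul hG hρ fun v hv => ?_
      have hv' : v ∈ b e (8 * (1 + 1)) := by rw [hb]; omega
      have := (Finset.single_le_sum (f := fun v => ρ v ^ p) (fun v _ => hg v) hv').trans h1
      exact (Real.rpow_le_rpow_iff (hρ0 v) hB hp0).1 this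
    have h3 : (G.dist e z : ℝ) ≤ 3 := by exact_mod_cast hez
    nlinarith
  | succ k ih =>
    intro E F e e' z z' B hE hF he he' hz hz' hd hd' hez hB hW
    have hHk : 1 ≤ H ^ k := Nat.one_le_pow _ _ (by omega)
    have hHs : H ^ (k + 1) = 32 * N * H ^ k := by rw [pow_succ, mul_comm, hH]
    have hHle : 32 * H ^ k ≤ H ^ (k + 1) := by
      rw [hHs]; exact Nat.mul_le_mul_right _ (by omega)
    have hW1 := hW (k + 1) le_rfl (by omega)
    have hXN : (B * τ ^ (k + 1)) ^ p = N * (B * τ ^ k) ^ p := by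
      rw [pow_succ, ← mul_assoc, Real.mul_rpow (by positivity) hτ.le, hτN, mul_comm]
    have hW1' : ∑ v ∈ b e (16 * (32 * N * H ^ k)), ρ v ^ p ≤ N * (B * τ ^ k) ^ p := by
      rw [← hXN, ← hHs]
      refine le_trans (le_of_eq ?_) hW1
      congr 2; omega
    obtain ⟨x, hx, hx1, hx2, hx3⟩ := exists_sum_ball_le hG hb hg hE he he' hN
      (by rw [← hHs]; exact hd) (by simp) hW1'
    obtain ⟨y, hy, hy1, hy2, hy3⟩ := exists_sum_ball_le hG hb hg hF hz hz' hN
      (by rw [← hHs]; exact hd') (by rw [← hHs]; exact hez) hW1'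
    rw [← hHs] at hx1 hy1
    have hey := hG.dist_triangle (u := e) (v := z) (w := y)
    -- Energy hypotheses one scale down: for `j = k` the selected ball supplies the gain `1 / N`;
    -- for `j > k` the ball about `w` lies in the parent's ball. The scales up to `k + l` are
    -- carried along because Loewner paths may wander that far.
    have hchild : ∀ w, G.dist e w ≤ 4 * H ^ (k + 1) →
        ∑ v ∈ b w (16 * H ^ k), ρ v ^ p ≤ (B * τ ^ k) ^ p →
        ∀ j, k ≤ j → j ≤ k + l →
          ∑ v ∈ b w (8 * (H ^ j + H ^ k)), ρ v ^ p ≤ (B * τ ^ j) ^ p := by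
      intro w hw hw' j hj hjl
      rcases hj.eq_or_lt with rfl | hj
      · refine le_trans (le_of_eq ?_) hw'
        congr 2; omega
      · exact (sum_ball_le hG hb hg (by omega)).trans (hW j hj (by omega))
    have hchx := hchild x (by omega) hx3
    have hchy := hchild y (by omega) hy3
    have hq : 0 ≤ (τ / η) ^ k := by positivity
    have hq4 : 4 * (τ / η) ^ k ≤ (τ / η) ^ (k + 1) := by
      rw [pow_succ, mul_comm]
      exact mul_le_mul_of_nonneg_left ((le_div_iff₀ hη).2 hτη) hq
    have hKB : 0 ≤ K * B := by positivity
    rcases le_or_gt (G.dist x y) (3 * H ^ k) with hxy | hxy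
    · obtain ⟨u, hu, v, hv, huv⟩ := ih E F x e y z B hE hF hx he hy hz
        (by rwa [G.dist_comm]) (by rwa [G.dist_comm]) hxy hB hchx
      refine ⟨u, hu, v, hv, huv.trans ?_⟩
      exact mul_le_mul_of_nonneg_left (by linarith) hKB
    -- Here `x` and `y` are far apart, so the joining set `S` has diameter at least `H ^ k` and can
    -- serve as the second set in both recursive calls.
    · have hxy' := hG.dist_triangle (u := x) (v := e) (w := y)
      rw [G.dist_comm (u := x) (v := e)] at hxy'
      obtain ⟨S, hS, ⟨g, hgS, hg'⟩, ⟨h, hhS, hh'⟩, hosc⟩ := hJ k x y e e' (B * τ ^ (k + 1 + l))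
        (by omega) hd (by positivity) ((sum_ball_le hG hb hg (by omega)).trans
          (hW (k + 1 + l) (by omega) le_rfl))
      have hgh : H ^ k ≤ G.dist g h := by
        have h1 := hG.dist_triangle (u := x) (v := g) (w := y)
        have h2 := hG.dist_triangle (u := g) (v := h) (w := y)
        rw [G.dist_comm (u := h)] at h2
        omega
      obtain ⟨u, hu, s, hs, hus⟩ := ih E S x e g h B hE hS hx he hgS hhS
        (by rwa [G.dist_comm]) hgh (by omega) hB hchx
      obtain ⟨v, hv, t, ht, hvt⟩ := ih F S y z h g B hF hS hy hz hhS hgS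
        (by rwa [G.dist_comm]) (by rwa [G.dist_comm]) (by omega) hB hchy
      refine ⟨u, hu, v, hv, ?_⟩
      have h1 := hosc s hs t ht
      have h2 := abs_sub_le (f u) (f s) (f v)
      have h3 := abs_sub_le (f s) (f t) (f v)
      rw [abs_sub_comm (f t)] at h3
      -- The two recursive errors cost `2 * K` and the jump another `2 * K`, in units of `B * (τ /
      -- η) ^ k`; `4 * η ≤ τ` absorbs the total.
      have h4 : J * (B * τ ^ (k + 1 + l)) / η ^ k = J * τ ^ (l + 1) * B * (τ / η) ^ k := by
        rw [div_pow, show k + 1 + l = (l + 1) + k by omega, pow_add]; ring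
      have h5 : J * τ ^ (l + 1) * B * (τ / η) ^ k ≤ 2 * K * B * (τ / η) ^ k := by gcongr
      have h6 := mul_le_mul_of_nonneg_left hq4 hKB
      nlinarith

/-- With `B = X / τ ^ k`, one bound on the largest ball implies those at all scales from `k` to `k +
l`, because `1 ≤ τ`. -/
lemma exists_abs_sub_le_div (hG : G.Connected)
    (hb : ∀ x n v, v ∈ b x n ↔ G.dist x v < n) (hρ0 : ∀ v, 0 ≤ ρ v)
    (hρ : ∀ v w, G.Adj v w → |f v - f w| ≤ ρ v) {p : ℝ} (hp : 1 ≤ p) {N l : ℕ} (hN : 1 ≤ N)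
    {J η τ K : ℝ} (hJ : HasJumps G f ρ b p (32 * N) l J η) (hη : 0 < η) (hτ : 1 ≤ τ)
    (hτN : τ ^ p = N) (hτη : 4 * η ≤ τ) (hK : 3 ≤ K) (hKJ : J * τ ^ (l + 1) ≤ 2 * K) (k : ℕ)
    {E F : Set V} {e e' z z' : V} {X : ℝ} (hE : WalkConnected G E) (hF : WalkConnected G F)
    (he : e ∈ E) (he' : e' ∈ E) (hz : z ∈ F) (hz' : z' ∈ F) (hd : (32 * N) ^ k ≤ G.dist e e')
    (hd' : (32 * N) ^ k ≤ G.dist z z') (hez : G.dist e z ≤ 3 * (32 * N) ^ k) (hX : 0 ≤ X)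
    (hW : ∑ v ∈ b e (16 * (32 * N) ^ (k + l)), ρ v ^ p ≤ X ^ p) :
    ∃ u ∈ E, ∃ v ∈ F, |f u - f v| ≤ K * X / η ^ k := by
  have hτ0 : 0 < τ := by linarith
  have hg : ∀ v, 0 ≤ ρ v ^ p := fun v => Real.rpow_nonneg (hρ0 v) p
  obtain ⟨u, hu, v, hv, h⟩ := exists_abs_sub_le_of_walkConnected hG hb hρ0 hρ hp hN hJ hη hτ0 hτN
    hτη hK hKJ k E F e e' z z' (X / τ ^ k) hE hF he he' hz hz' hd hd' hez (by positivity) (by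
      intro j hj hjl
      have h1 : (32 * N) ^ j ≤ (32 * N) ^ (k + l) := Nat.pow_le_pow_right (by omega) hjl
      have h2 : (32 * N) ^ k ≤ (32 * N) ^ (k + l) := Nat.pow_le_pow_right (by omega) (by omega)
      refine (sum_ball_le hG hb hg (by rw [SimpleGraph.dist_self]; omega)).trans
        (hW.trans (Real.rpow_le_rpow hX ?_ (by linarith)))
      rw [div_mul_eq_mul_div, le_div_iff₀ (by positivity)]
      exact mul_le_mul_of_nonneg_left (pow_le_pow_right₀ hτ hj) hX)
  refine ⟨u, hu, v, hv, h.trans (le_of_eq ?_)⟩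
  rw [div_pow]; field_simp

/-! ### Multiscale approximation -/

/-- Multiscale approximations of a function at scales `H ^ k`, with errors controlled by the
`p`-energy in balls of radius comparable to `H ^ k`. -/
theorem exists_approximation (hG : G.Connected)
    (hb : ∀ x n v, v ∈ b x n ↔ G.dist x v < n) (hρ0 : ∀ v, 0 ≤ ρ v)
    (hρ : ∀ v w, G.Adj v w → |f v - f w| ≤ ρ v) {p : ℝ} (hp : 1 ≤ p) {N l : ℕ} (hN : 1 ≤ N)
    {J η τ K : ℝ}
    (hJ : HasJumps G f ρ b p (32 * N) l J η) (hη : 0 < η) (hτ : 1 ≤ τ)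
    (hτN : τ ^ p = N) (hτη : 4 * η ≤ τ) (hK : 3 ≤ K) (hKJ : J * τ ^ (l + 1) ≤ 2 * K)
    {H Q : ℕ} (hH : H = 32 * N) (hQ : Q = 17 * H ^ (l + 1))
    {Far : ℕ → V → Prop}
    (hFar : ∀ k x, Far k x ↔ ∃ y, H ^ (k + 1) + 2 * H ^ k ≤ G.dist x y)
    {X : ℕ → V → ℝ} (hX : ∀ k x, X k x = (∑ v ∈ b x (Q * H ^ k), ρ v ^ p) ^ (1 / p)) :
    ∃ a : ℕ → V → ℝ, (∀ x, Far 0 x → a 0 x = f x) ∧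
      (∀ k x, Far (k + 1) x → |a k x - a (k + 1) x| ≤
        (J + K + K / η) * (X k x / η ^ k + X (k + 1) x / η ^ (k + 1))) ∧
      ∀ k x x', Far k x → Far k x' → G.dist x x' ≤ H ^ k →
        |a k x - a k x'| ≤ (J + K + K / η) * (X k x / η ^ k + X k x' / η ^ k) := by
  have hp0 : 0 < p := by linarith
  have hg : ∀ v, 0 ≤ ρ v ^ p := fun v => Real.rpow_nonneg (hρ0 v) p
  have hH1 : 1 ≤ H := by omega
  have hX0 : ∀ k x, 0 ≤ X k x := fun k x => by
    rw [hX]; exact Real.rpow_nonneg (Finset.sum_nonneg fun v _ => hg v) _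
  have hXp : ∀ k x, X k x ^ p = ∑ v ∈ b x (Q * H ^ k), ρ v ^ p := fun k x => by
    rw [hX, ← Real.rpow_mul (Finset.sum_nonneg fun v _ => hg v), one_div_mul_cancel hp0.ne',
      Real.rpow_one]
  have hHk : ∀ k, 1 ≤ H ^ k := fun k => Nat.one_le_pow _ _ (by omega)
  have hHs : ∀ k, H ^ k ≤ H ^ (k + 1) := fun k => Nat.pow_le_pow_right (by omega) (by omega)
  have hQk : ∀ k, Q * H ^ k = 17 * H ^ (k + 1 + l) := fun k => by
    rw [hQ, show k + 1 + l = (l + 1) + k by omega, pow_add _ (l + 1)]; ring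
  have hHl : ∀ k, H ^ k ≤ H ^ (k + 1 + l) := fun k => Nat.pow_le_pow_right (by omega) (by omega)
  have hHl' : ∀ k, H ^ (k + l) ≤ H ^ (k + 1 + l) :=
    fun k => Nat.pow_le_pow_right (by omega) (by omega)
  have hex : ∀ k x, ∃ (S : Set V) (g h : V), Far k x → WalkConnected G S ∧ g ∈ S ∧ h ∈ S ∧
      G.dist x g < H ^ k ∧ H ^ (k + 1) ≤ G.dist g h ∧
      ∀ u ∈ S, ∀ v ∈ S, |f u - f v| ≤ J * X k x / η ^ k := by
    intro k x
    by_cases hf : Far k x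
    · obtain ⟨y, hy⟩ := (hFar k x).1 hf
      -- The ends of `S` lie within `H ^ k` of `x` and `z`; the extra `2 * H ^ k` leaves them at
      -- least `H ^ (k + 1)` apart, enough for a comparison at scale `k + 1`.
      obtain ⟨z, hz, -⟩ := exists_dist_eq_of_le hG hy
      obtain ⟨S, hS, ⟨g, hg1, hg2⟩, ⟨h, hh1, hh2⟩, hosc⟩ := hJ k x z x z (X k x)
        (by rw [hz, ← hH]; have := hHs k; omega) (by rw [hz, ← hH]; omega) (hX0 k x) (by
          rw [hXp, ← hH]
          refine sum_ball_le hG hb hg ?_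
          rw [SimpleGraph.dist_self, hQk]; omega)
      rw [← hH] at hg2 hh2
      refine ⟨S, g, h, fun _ => ⟨hS, hg1, hh1, hg2, ?_, hosc⟩⟩
      have h1 := hG.dist_triangle (u := x) (v := g) (w := z)
      have h2 := hG.dist_triangle (u := g) (v := h) (w := z)
      rw [G.dist_comm (u := h)] at h2
      omega
    · exact ⟨∅, x, x, fun h => absurd h hf⟩
  choose S g h hS using hex
  refine ⟨fun k x => f (g k x), fun x hx => ?_, fun k x hx => ?_, fun k x x' hx hx' hxx' => ?_⟩
  -- At scale 0 the open ball of radius 1 contains only `x`.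
  · have h1 := (hS 0 x hx).2.2.2.1
    have h2 : G.dist x (g 0 x) = 0 := by simpa using h1
    exact congrArg f ((hG.dist_eq_zero_iff).1 h2).symm
  · have hx' : Far k x := by
      rw [hFar] at hx ⊢
      obtain ⟨y, hy⟩ := hx
      exact ⟨y, by have := hHs k; have := hHs (k + 1); omega⟩
    obtain ⟨hS1, hg1, hh1, hxg1, hgh1, ho1⟩ := hS k x hx'
    obtain ⟨hS2, hg2, hh2, hxg2, hgh2, ho2⟩ := hS (k + 1) x hx
    have hgg := hG.dist_triangle (u := g k x) (v := x) (w := g (k + 1) x)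
    rw [G.dist_comm (u := g k x) (v := x)] at hgg
    -- The energy ball of radius `16 * H ^ (k + 1 + l)` about `g k x` lies in the ball of radius `Q
    -- * H ^ k` about `x`; this is why `Q` has the factor 17.
    obtain ⟨u, hu, v, hv, huv⟩ := exists_abs_sub_le_div hG hb hρ0 hρ hp hN hJ hη hτ hτN hτη hK hKJ
      (k + 1) hS1 hS2 hg1 hh1 hg2 hh2 (by rw [← hH]; exact hgh1)
      (by rw [← hH]; exact (hHs _).trans hgh2) (by rw [← hH]; have := hHs k; omega) (hX0 k x) (by
        rw [hXp, ← hH]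
        refine sum_ball_le hG hb hg ?_
        rw [hQk]; have := hHl k; omega)
    have h1 := ho1 _ hg1 _ hu
    have h2 := ho2 _ hv _ hg2
    have h3 := abs_sub_le (f (g k x)) (f u) (f (g (k + 1) x))
    have h4 := abs_sub_le (f u) (f v) (f (g (k + 1) x))
    have e1 : J * X k x / η ^ k = J * (X k x / η ^ k) := by ring
    have e2 : J * X (k + 1) x / η ^ (k + 1) = J * (X (k + 1) x / η ^ (k + 1)) := by ring
    have e3 : K * X k x / η ^ (k + 1) = K / η * (X k x / η ^ k) := by
      rw [pow_succ]; field_simp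
    have p1 : 0 ≤ X k x / η ^ k := div_nonneg (hX0 _ _) (by positivity)
    have p2 : 0 ≤ X (k + 1) x / η ^ (k + 1) := div_nonneg (hX0 _ _) (by positivity)
    have p3 : 0 ≤ K / η := by positivity
    have p4 := mul_nonneg p3 p2
    have p5 : 0 ≤ K * (X k x / η ^ k) := by positivity
    have p6 : 0 ≤ K * (X (k + 1) x / η ^ (k + 1)) := by positivity
    linarith
  · obtain ⟨hS1, hg1, hh1, hxg1, hgh1, ho1⟩ := hS k x hx
    obtain ⟨hS2, hg2, hh2, hxg2, hgh2, ho2⟩ := hS k x' hx'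
    have hgg := hG.dist_triangle (u := g k x) (v := x) (w := g k x')
    have hgg' := hG.dist_triangle (u := x) (v := x') (w := g k x')
    rw [G.dist_comm (u := g k x) (v := x)] at hgg
    obtain ⟨u, hu, v, hv, huv⟩ := exists_abs_sub_le_div hG hb hρ0 hρ hp hN hJ hη hτ hτN hτη hK hKJ
      k hS1 hS2 hg1 hh1 hg2 hh2 (by rw [← hH]; exact (hHs _).trans hgh1)
      (by rw [← hH]; exact (hHs _).trans hgh2) (by rw [← hH]; omega) (hX0 k x) (by
        rw [hXp, ← hH]
        refine sum_ball_le hG hb hg ?_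
        rw [hQk]; have := hHl k; have := hHl' k; omega)
    have h1 := ho1 _ hg1 _ hu
    have h2 := ho2 _ hv _ hg2
    have h3 := abs_sub_le (f (g k x)) (f u) (f (g k x'))
    have h4 := abs_sub_le (f u) (f v) (f (g k x'))
    have e1 : J * X k x / η ^ k = J * (X k x / η ^ k) := by ring
    have e2 : J * X k x' / η ^ k = J * (X k x' / η ^ k) := by ring
    have e3 : K * X k x / η ^ k = K * (X k x / η ^ k) := by ring
    have p1 : 0 ≤ X k x / η ^ k := div_nonneg (hX0 _ _) (by positivity)
    have p2 : 0 ≤ X k x' / η ^ k := div_nonneg (hX0 _ _) (by positivity)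
    have p3 : 0 ≤ K / η := by positivity
    have p4 := mul_nonneg p3 p2
    have p4' := mul_nonneg p3 p1
    have p6 : 0 ≤ K * (X k x' / η ^ k) := by positivity
    linarith

/-! ### Telescoping, chaining and summation -/

lemma abs_sub_le_sum_of_telescoping {a Y : ℕ → ℝ} {C : ℝ} (hC : 0 ≤ C) (hY : ∀ k, 0 ≤ Y k) (n : ℕ)
    (h : ∀ k < n, |a k - a (k + 1)| ≤ C * (Y k + Y (k + 1))) :
    |a 0 - a n| ≤ 2 * C * ∑ k ∈ Finset.range (n + 1), Y k := by
  -- Reserving `C * Y n` lets the induction count each `Y k` at most twice.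
  have key : |a 0 - a n| + C * Y n ≤ 2 * C * ∑ k ∈ Finset.range (n + 1), Y k := by
    induction n with
    | zero => simp; nlinarith [mul_nonneg hC (hY 0)]
    | succ n ih =>
      rw [Finset.sum_range_succ]
      have h1 := ih fun k hk => h k (by omega)
      have h2 := h n (by omega)
      have h3 := abs_sub_le (a 0) (a n) (a (n + 1))
      nlinarith
  have := mul_nonneg hC (hY n)
  linarith

/-- Chaining along a geodesic from `x` to `y`. -/
lemma abs_sub_le_of_chain (hG : G.Connected) {a : V → ℝ} {T : ℝ} (hT : 0 ≤ T) {x : V} {n s : ℕ}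
    (h : ∀ y z, G.dist x y ≤ n → G.dist x z ≤ n → G.dist y z ≤ s → |a y - a z| ≤ T) (m : ℕ) :
    ∀ y, G.dist x y ≤ n → G.dist x y ≤ m * s → |a y - a x| ≤ m * T := by
  induction m with
  | zero =>
    intro y _ hy
    have : G.dist x y = 0 := by simpa using hy
    rw [(hG.dist_eq_zero_iff).1 this]; simp
  | succ m ih =>
    intro y hyn hy
    push_cast
    rcases le_or_gt (G.dist x y) s with hs | hs
    · have := h y x hyn (by simp) (by rwa [G.dist_comm])
      nlinarith [mul_nonneg (Nat.cast_nonneg (α := ℝ) m) hT]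
    · obtain ⟨z, hz1, hz2⟩ := exists_dist_eq_of_le hG (Nat.sub_le (G.dist x y) s)
      rw [add_mul, one_mul] at hy
      have h1 := ih z (by omega) (by omega)
      have h2 := h y z hyn (by omega) (by rw [G.dist_comm]; omega)
      have h3 := abs_sub_le (a y) (a z) (a x)
      linarith

lemma geom_sum_range_succ_le {q : ℝ} (hq : 1 < q) (n : ℕ) :
    ∑ k ∈ Finset.range (n + 1), q ^ k ≤ q / (q - 1) * q ^ n := by
  have : 0 < q - 1 := by linarith
  rw [geom_sum_eq hq.ne', div_mul_eq_mul_div, div_le_div_iff_of_pos_right this, pow_succ]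
  linarith

/-- Each term is at most `M ^ (1 / p) * σ ^ k` with `σ ^ p = ω`, so summing a geometric series
replaces Hölder's inequality and covers `p = 1` too. -/
lemma rpow_sum_range_le {p ω : ℝ} (hp : 1 ≤ p) (hω : 1 < ω) {s : ℕ → ℝ} (hs : ∀ k, 0 ≤ s k)
    (n : ℕ) : (∑ k ∈ Finset.range (n + 1), s k) ^ p ≤
      (ω ^ (1 / p) / (ω ^ (1 / p) - 1)) ^ p * ω ^ n *
        ∑ k ∈ Finset.range (n + 1), s k ^ p / ω ^ k := by
  have hp0 : 0 < p := by linarith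
  have hω0 : 0 < ω := by linarith
  set σ := ω ^ (1 / p) with hσ
  have hσ1 : 1 < σ := Real.one_lt_rpow hω (by positivity)
  have hσ0 : 0 < σ := by linarith
  have hσp : σ ^ p = ω := by
    rw [hσ, ← Real.rpow_mul hω0.le, one_div_mul_cancel hp0.ne', Real.rpow_one]
  have hσpk : ∀ k : ℕ, (σ ^ k) ^ p = ω ^ k := fun k => by
    rw [← hσp, ← Real.rpow_natCast, ← Real.rpow_natCast, ← Real.rpow_mul hσ0.le,
      ← Real.rpow_mul hσ0.le, mul_comm]
  set M := ∑ k ∈ Finset.range (n + 1), s k ^ p / ω ^ k with hM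
  have hterm : ∀ k, 0 ≤ s k ^ p / ω ^ k := fun k =>
    div_nonneg (Real.rpow_nonneg (hs k) _) (by positivity)
  have hM0 : 0 ≤ M := Finset.sum_nonneg fun k _ => hterm k
  have hsk : ∀ k ∈ Finset.range (n + 1), s k ≤ M ^ (1 / p) * σ ^ k := by
    intro k hk
    rw [← Real.rpow_le_rpow_iff (hs k) (by positivity) hp0, Real.mul_rpow (by positivity)
      (by positivity), hσpk, ← Real.rpow_mul hM0, one_div_mul_cancel hp0.ne', Real.rpow_one,
      ← div_le_iff₀ (by positivity)]
    exact Finset.single_le_sum (f := fun k => s k ^ p / ω ^ k) (fun k _ => hterm k) hk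
  have h1 : ∑ k ∈ Finset.range (n + 1), s k ≤ M ^ (1 / p) * (σ / (σ - 1) * σ ^ n) :=
    (Finset.sum_le_sum hsk).trans (by
      rw [← Finset.mul_sum]
      exact mul_le_mul_of_nonneg_left (geom_sum_range_succ_le hσ1 n) (by positivity))
  have hσ' : 0 ≤ σ / (σ - 1) := div_nonneg hσ0.le (by linarith)
  refine (Real.rpow_le_rpow (Finset.sum_nonneg fun k _ => hs k) h1 hp0.le).trans (le_of_eq ?_)
  rw [Real.mul_rpow (by positivity) (by positivity), Real.mul_rpow hσ' (by positivity), hσpk,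
    ← Real.rpow_mul hM0, one_div_mul_cancel hp0.ne', Real.rpow_one]
  ring

/-- Double counting: by symmetry of the distance, `v` lies in `b y m` for at most `M` centres `y`.
-/
lemma sum_sum_ball_le (hb : ∀ x n v, v ∈ b x n ↔ G.dist x v < n) {g : V → ℝ} (hg : ∀ v, 0 ≤ g v)
    {B S : Finset V} {m : ℕ} (hBS : ∀ y ∈ B, b y m ⊆ S) {M : ℝ} (hM : ∀ v, ((b v m).card : ℝ) ≤ M) :
    ∑ y ∈ B, ∑ v ∈ b y m, g v ≤ M * ∑ v ∈ S, g v := by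
  classical
  rw [Finset.sum_comm' (t' := S) (s' := fun v => B.filter fun y => v ∈ b y m), Finset.mul_sum]
  · refine Finset.sum_le_sum fun v _ => ?_
    rw [Finset.sum_const, nsmul_eq_mul]
    refine mul_le_mul_of_nonneg_right (le_trans ?_ (hM v)) (hg v)
    refine Nat.cast_le.2 (Finset.card_le_card fun y hy => ?_)
    have := (Finset.mem_filter.1 hy).2
    rw [hb] at this ⊢
    rwa [G.dist_comm]
  · intro y v
    rw [Finset.mem_filter]
    exact ⟨fun h => ⟨⟨h.1, h.2⟩, hBS y h.1 h.2⟩, fun h => h.1⟩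

lemma rpow_add_le_two_rpow_mul {p x y : ℝ} (hp : 1 ≤ p) (hx : 0 ≤ x) (hy : 0 ≤ y) :
    (x + y) ^ p ≤ 2 ^ p * (x ^ p + y ^ p) := by
  have hp0 : 0 ≤ p := by linarith
  have hxp := Real.rpow_nonneg hx p
  have hyp := Real.rpow_nonneg hy p
  have h2 : (0 : ℝ) ≤ 2 ^ p := by positivity
  rcases le_total x y with h | h
  · refine (Real.rpow_le_rpow (by positivity) (by linarith : x + y ≤ 2 * y) hp0).trans ?_
    rw [Real.mul_rpow (by norm_num) hy]
    exact mul_le_mul_of_nonneg_left (by linarith) h2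
  · refine (Real.rpow_le_rpow (by positivity) (by linarith : x + y ≤ 2 * x) hp0).trans ?_
    rw [Real.mul_rpow (by norm_num) hx]
    exact mul_le_mul_of_nonneg_left (by linarith) h2

/-! ### Deviation estimates at small and large radii -/

/-- Geodesics from `x` have length below `R₀`, so crude pointwise bounds suffice. -/
lemma sum_abs_sub_rpow_le_of_bounded_radius (hG : G.Connected) (hρ0 : ∀ v, 0 ≤ ρ v)
    (hρ : ∀ v w, G.Adj v w → |f v - f w| ≤ ρ v) {p α β M₀ R₀ R : ℝ} (hp : 1 ≤ p)
    (hβ : 0 ≤ β) (hα : 0 ≤ α) (hM₀ : 0 ≤ M₀)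
    (hR : 1 ≤ R) (hRR : R ≤ R₀) {x : V} {B S : Finset V} (hB : ∀ v ∈ B, (G.dist x v : ℝ) < R)
    (hS : ∀ v, (G.dist x v : ℝ) < R → v ∈ S) (hcard : (B.card : ℝ) ≤ M₀ * R ^ α) :
    ∑ y ∈ B, |f y - f x| ^ p ≤ M₀ * R₀ ^ α * R₀ ^ p * R ^ β * ∑ v ∈ S, ρ v ^ p := by
  have hp0 : 0 < p := by linarith
  have hR0 : 0 ≤ R := by linarith
  have hR00 : 0 ≤ R₀ := by linarith
  set W := ∑ v ∈ S, ρ v ^ p with hW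
  have hg : ∀ v, 0 ≤ ρ v ^ p := fun v => Real.rpow_nonneg (hρ0 v) p
  have hW0 : 0 ≤ W := Finset.sum_nonneg fun v _ => hg v
  have hy : ∀ y ∈ B, |f y - f x| ^ p ≤ R₀ ^ p * W := by
    intro y hy
    have hd := hB y hy
    have h1 : |f x - f y| ≤ G.dist x y * W ^ (1 / p) := by
      refine abs_sub_le_dist_mul hG hρ fun v hv => ?_
      have hv' : (G.dist x v : ℝ) ≤ G.dist x y := by exact_mod_cast hv
      rw [← Real.rpow_le_rpow_iff (hρ0 v) (by positivity) hp0, ← Real.rpow_mul hW0,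
        one_div_mul_cancel hp0.ne', Real.rpow_one]
      exact Finset.single_le_sum (f := fun v => ρ v ^ p) (fun v _ => hg v) (hS v (by linarith))
    have h2 : |f y - f x| ≤ R₀ * W ^ (1 / p) := by
      rw [abs_sub_comm]
      exact h1.trans (mul_le_mul_of_nonneg_right (by linarith) (by positivity))
    refine (Real.rpow_le_rpow (abs_nonneg _) h2 hp0.le).trans (le_of_eq ?_)
    rw [Real.mul_rpow hR00 (by positivity), ← Real.rpow_mul hW0,
      one_div_mul_cancel hp0.ne', Real.rpow_one]
  refine (Finset.sum_le_sum hy).trans ?_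
  rw [Finset.sum_const, nsmul_eq_mul]
  have h1 : (1 : ℝ) ≤ R ^ β := Real.one_le_rpow hR hβ
  have h2 : (B.card : ℝ) ≤ M₀ * R₀ ^ α := hcard.trans
    (mul_le_mul_of_nonneg_left (Real.rpow_le_rpow hR0 hRR hα) hM₀)
  calc (B.card : ℝ) * (R₀ ^ p * W) ≤ M₀ * R₀ ^ α * (R₀ ^ p * W) := by gcongr
    _ = M₀ * R₀ ^ α * R₀ ^ p * 1 * W := by ring
    _ ≤ M₀ * R₀ ^ α * R₀ ^ p * R ^ β * W := by gcongr

/-- The constant in the Poincaré inequality at large scales. -/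
def largeScaleConst (p α M₀ C ω : ℝ) (m Q : ℕ) : ℝ :=
  2 ^ p * (2 * C) ^ p * ((ω ^ (1 / p) / (ω ^ (1 / p) - 1)) ^ p * (M₀ * (Q : ℝ) ^ α) *
    (ω / (ω - 1)) + m ^ p * (M₀ * (m : ℝ) ^ α))

theorem sum_abs_sub_rpow_le_of_approximation (hG : G.Connected)
    (hb : ∀ x n v, v ∈ b x n ↔ G.dist x v < n) (hρ0 : ∀ v, 0 ≤ ρ v)
    {p α ζ M₀ R C η ω : ℝ} (hp : 1 ≤ p) (hα : 0 ≤ α) (hM₀ : 0 ≤ M₀) (hC : 0 ≤ C) (hη : 0 < η)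
    {H Q n m : ℕ} (hH : 2 ≤ H) (hηp : η ^ p = (H : ℝ) ^ ζ)
    (hω : 1 < ω) (hω2 : ω * ω = (H : ℝ) ^ (α - ζ)) (hζα : 0 ≤ α - ζ)
    (hQ : 1 ≤ Q) (hR : (Q * H ^ n : ℕ) + 1 ≤ R) (hRm : R ≤ (m * H ^ n : ℕ))
    {X : ℕ → V → ℝ} (hX : ∀ k x, X k x = (∑ v ∈ b x (Q * H ^ k), ρ v ^ p) ^ (1 / p))
    {a : ℕ → V → ℝ} {x : V} {B S : Finset V} (hB : ∀ v, v ∈ B ↔ (G.dist x v : ℝ) < R)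
    (hS : ∀ v, (G.dist x v : ℝ) < 2 * R - 1 → v ∈ S)
    (hcard : ∀ v k, ((b v (Q * H ^ k)).card : ℝ) ≤ M₀ * ((Q * H ^ k : ℕ) : ℝ) ^ α)
    (hcardB : (B.card : ℝ) ≤ M₀ * R ^ α)
    (ha0 : ∀ y ∈ B, a 0 y = f y)
    (ha : ∀ y ∈ B, ∀ k < n, |a k y - a (k + 1) y| ≤
      C * (X k y / η ^ k + X (k + 1) y / η ^ (k + 1)))
    (han : ∀ y ∈ B, ∀ z ∈ B, G.dist y z ≤ H ^ n →
      |a n y - a n z| ≤ C * (X n y / η ^ n + X n z / η ^ n)) :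
    ∑ y ∈ B, |f y - a n x| ^ p ≤
      largeScaleConst p α M₀ C ω m Q * R ^ (α - ζ) * ∑ v ∈ S, ρ v ^ p := by
  have hp0 : 0 < p := by linarith
  have hω0 : 0 < ω := by linarith
  have hH0 : (0 : ℝ) < H := by exact_mod_cast (by omega : 0 < H)
  have hg : ∀ v, 0 ≤ ρ v ^ p := fun v => Real.rpow_nonneg (hρ0 v) p
  set W := ∑ v ∈ S, ρ v ^ p with hW
  have hW0 : 0 ≤ W := Finset.sum_nonneg fun v _ => hg v
  have hX0 : ∀ k x, 0 ≤ X k x := fun k x => by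
    rw [hX]; exact Real.rpow_nonneg (Finset.sum_nonneg fun v _ => hg v) _
  have hXp : ∀ k x, X k x ^ p = ∑ v ∈ b x (Q * H ^ k), ρ v ^ p := fun k x => by
    rw [hX, ← Real.rpow_mul (Finset.sum_nonneg fun v _ => hg v), one_div_mul_cancel hp0.ne',
      Real.rpow_one]
  have hR0 : 0 ≤ R := by
    have : (0 : ℝ) ≤ (Q * H ^ n : ℕ) := by positivity
    linarith
  -- As `Q * H ^ n ≤ R - 1`, every energy ball centred in `B` stays within radius `2 * R - 1`.
  have hsub : ∀ y ∈ B, ∀ k ≤ n, b y (Q * H ^ k) ⊆ S := by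
    intro y hy k hk v hv
    rw [hb] at hv
    rw [hB] at hy
    apply hS
    have h1 : H ^ k ≤ H ^ n := Nat.pow_le_pow_right (by omega) hk
    have h2 : Q * H ^ k ≤ Q * H ^ n := Nat.mul_le_mul_left _ h1
    have h3 := hG.dist_triangle (u := x) (v := y) (w := v)
    have h4 : G.dist x v ≤ G.dist x y + Q * H ^ n := by omega
    have h5 : (G.dist x v : ℝ) ≤ G.dist x y + (Q * H ^ n : ℕ) := by exact_mod_cast h4
    linarith
  have hXW : ∀ y ∈ B, X n y ≤ W ^ (1 / p) := by
    intro y hy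
    rw [hX]
    exact Real.rpow_le_rpow (Finset.sum_nonneg fun v _ => hg v)
      (Finset.sum_le_sum_of_subset_of_nonneg (hsub y hy n le_rfl) fun v _ _ => hg v)
      (by positivity)
  have hηk : ∀ k : ℕ, (η ^ k) ^ p = ((H : ℝ) ^ ζ) ^ k := fun k => by
    rw [← hηp, ← Real.rpow_natCast, ← Real.rpow_natCast, ← Real.rpow_mul hη.le,
      ← Real.rpow_mul hη.le, mul_comm]
  have hHαζ : (H : ℝ) ^ α = (H : ℝ) ^ (α - ζ) * (H : ℝ) ^ ζ := by
    rw [← Real.rpow_add hH0]; congr 1; ring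
  have hHζ0 : 0 < (H : ℝ) ^ ζ := Real.rpow_pos_of_pos hH0 _
  have hcast : ∀ (q k : ℕ), ((q * H ^ k : ℕ) : ℝ) ^ α = (q : ℝ) ^ α * ((H : ℝ) ^ α) ^ k := by
    intro q k
    push_cast
    rw [Real.mul_rpow (by positivity) (by positivity)]
    congr 1
    rw [← Real.rpow_natCast, ← Real.rpow_natCast, ← Real.rpow_mul hH0.le,
      ← Real.rpow_mul hH0.le, mul_comm]
  set Y : ℕ → V → ℝ := fun k y => X k y / η ^ k with hY
  have hY0 : ∀ k y, 0 ≤ Y k y := fun k y => div_nonneg (hX0 k y) (by positivity)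
  have hYp : ∀ k y, Y k y ^ p = (∑ v ∈ b y (Q * H ^ k), ρ v ^ p) / ((H : ℝ) ^ ζ) ^ k := by
    intro k y
    rw [hY]; dsimp only
    rw [Real.div_rpow (hX0 k y) (by positivity), hXp, hηk]
  set T := 2 * C * (W ^ (1 / p) / η ^ n) with hT
  have hT0 : 0 ≤ T := by positivity
  have hTp : T ^ p = (2 * C) ^ p * (W / ((H : ℝ) ^ ζ) ^ n) := by
    rw [hT, Real.mul_rpow (by positivity) (by positivity),
      Real.div_rpow (by positivity) (by positivity), hηk, ← Real.rpow_mul hW0,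
      one_div_mul_cancel hp0.ne', Real.rpow_one]
  have hchain : ∀ y ∈ B, |a n y - a n x| ≤ m * T := by
    have hlt : ∀ y, G.dist x y ≤ ⌈R⌉₊ - 1 → y ∈ B := by
      intro y hy
      rw [hB]
      have h1 : 1 ≤ ⌈R⌉₊ := Nat.one_le_ceil_iff.2 (by
        have : (0 : ℝ) ≤ (Q * H ^ n : ℕ) := by positivity
        linarith)
      exact Nat.lt_ceil.1 (by omega)
    intro y hy
    have hy1 := (hB y).1 hy
    have hy2 : G.dist x y < ⌈R⌉₊ := Nat.lt_ceil.2 hy1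
    refine abs_sub_le_of_chain hG (a := a n) hT0 (s := H ^ n) (n := ⌈R⌉₊ - 1) ?_ m y (by omega) ?_
    · intro y z hy hz hyz
      refine (han y (hlt y hy) z (hlt z hz) hyz).trans ?_
      have h1 := div_le_div_of_nonneg_right (hXW y (hlt y hy)) (pow_nonneg hη.le n)
      have h2 := div_le_div_of_nonneg_right (hXW z (hlt z hz)) (pow_nonneg hη.le n)
      rw [hT]
      nlinarith
    · have : (G.dist x y : ℝ) ≤ (m * H ^ n : ℕ) := by linarith
      exact_mod_cast this
  have hpt : ∀ y ∈ B, |f y - a n x| ^ p ≤ 2 ^ p * ((2 * C) ^ p *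
      (∑ k ∈ Finset.range (n + 1), Y k y) ^ p + m ^ p * T ^ p) := by
    intro y hy
    have h1 := abs_sub_le_sum_of_telescoping (a := fun k => a k y) (Y := fun k => Y k y) hC
      (fun k => hY0 k y) n (ha y hy)
    simp only [ha0 y hy] at h1
    have h2 := abs_sub_le (f y) (a n y) (a n x)
    have h3 := hchain y hy
    have hs : 0 ≤ ∑ k ∈ Finset.range (n + 1), Y k y := Finset.sum_nonneg fun k _ => hY0 k y
    refine (Real.rpow_le_rpow (abs_nonneg _) (h2.trans (add_le_add h1 h3)) hp0.le).trans ?_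
    refine (rpow_add_le_two_rpow_mul hp (by positivity) (by positivity)).trans (le_of_eq ?_)
    rw [Real.mul_rpow (by positivity) hs, Real.mul_rpow (by positivity) hT0]
  set D := (ω ^ (1 / p) / (ω ^ (1 / p) - 1)) ^ p with hD
  have hD0 : 0 ≤ D := Real.rpow_nonneg (div_nonneg (by positivity)
    (by have := Real.one_lt_rpow hω (z := 1 / p) (by positivity); linarith)) _
  -- With `ω ^ 2 = H ^ (α - ζ)`, overlap `H ^ (α * k)` over `H ^ (ζ * k) * ω ^ k` leaves `ω ^ k`.
  -- The series is of order `ω ^ n`, and the prefactor `ω ^ n` completes `H ^ ((α - ζ) * n)`.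
  have hmain : ∑ y ∈ B, (∑ k ∈ Finset.range (n + 1), Y k y) ^ p ≤
      D * (M₀ * (Q : ℝ) ^ α) * (ω / (ω - 1)) * ((H : ℝ) ^ (α - ζ)) ^ n * W := by
    calc ∑ y ∈ B, (∑ k ∈ Finset.range (n + 1), Y k y) ^ p
        ≤ ∑ y ∈ B, D * ω ^ n * ∑ k ∈ Finset.range (n + 1), Y k y ^ p / ω ^ k :=
          Finset.sum_le_sum fun y _ => rpow_sum_range_le hp hω (fun k => hY0 k y) n
      _ = D * ω ^ n * ∑ k ∈ Finset.range (n + 1), (∑ y ∈ B, ∑ v ∈ b y (Q * H ^ k), ρ v ^ p) /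
            (((H : ℝ) ^ ζ) ^ k * ω ^ k) := by
          rw [← Finset.mul_sum, Finset.sum_comm]
          congr 1
          refine Finset.sum_congr rfl fun k _ => ?_
          rw [Finset.sum_div]
          refine Finset.sum_congr rfl fun y _ => ?_
          rw [hYp, div_div]
      _ ≤ D * ω ^ n * ∑ k ∈ Finset.range (n + 1), M₀ * (Q : ℝ) ^ α * W * ω ^ k := by
          gcongr with k hk
          rw [Finset.mem_range] at hk
          rw [div_le_iff₀ (by positivity)]
          refine (sum_sum_ball_le hb hg (fun y hy => hsub y hy k (by omega))
            (fun v => hcard v k)).trans (le_of_eq ?_)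
          rw [hcast, hHαζ, ← hω2, mul_pow, mul_pow]
          ring
      _ ≤ D * ω ^ n * (M₀ * (Q : ℝ) ^ α * W * (ω / (ω - 1) * ω ^ n)) := by
          rw [← Finset.mul_sum]
          gcongr
          exact geom_sum_range_succ_le hω n
      _ = _ := by rw [← hω2, mul_pow]; ring
  have hHn : ((H : ℝ) ^ (α - ζ)) ^ n ≤ R ^ (α - ζ) := by
    rw [← Real.rpow_natCast, ← Real.rpow_mul hH0.le, mul_comm, Real.rpow_mul hH0.le,
      Real.rpow_natCast]
    refine Real.rpow_le_rpow (by positivity) (le_trans ?_ hR) hζα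
    have h1 : H ^ n ≤ Q * H ^ n := Nat.le_mul_of_pos_left _ hQ
    have h2 : ((H ^ n : ℕ) : ℝ) ≤ (Q * H ^ n : ℕ) := by exact_mod_cast h1
    push_cast at h2 ⊢
    linarith
  have hsecond : (B.card : ℝ) * T ^ p ≤
      (2 * C) ^ p * (M₀ * (m : ℝ) ^ α) * ((H : ℝ) ^ (α - ζ)) ^ n * W := by
    have h1 : (B.card : ℝ) ≤ M₀ * ((m : ℝ) ^ α * ((H : ℝ) ^ α) ^ n) := by
      rw [← hcast]
      exact hcardB.trans (mul_le_mul_of_nonneg_left (Real.rpow_le_rpow hR0 hRm hα) hM₀)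
    refine (mul_le_mul_of_nonneg_right h1 (Real.rpow_nonneg hT0 _)).trans (le_of_eq ?_)
    rw [hTp, hHαζ, mul_pow]
    field_simp
  have hω1 : 0 ≤ ω / (ω - 1) := div_nonneg hω0.le (by linarith)
  calc ∑ y ∈ B, |f y - a n x| ^ p
      ≤ ∑ y ∈ B, 2 ^ p * ((2 * C) ^ p *
        (∑ k ∈ Finset.range (n + 1), Y k y) ^ p + m ^ p * T ^ p) := Finset.sum_le_sum hpt
    _ = 2 ^ p * ((2 * C) ^ p * (∑ y ∈ B, (∑ k ∈ Finset.range (n + 1), Y k y) ^ p) +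
          m ^ p * (B.card * T ^ p)) := by
        rw [← Finset.mul_sum, Finset.sum_add_distrib, ← Finset.mul_sum, Finset.sum_const,
          nsmul_eq_mul]
        ring
    _ ≤ 2 ^ p * ((2 * C) ^ p *
          (D * (M₀ * (Q : ℝ) ^ α) * (ω / (ω - 1)) * ((H : ℝ) ^ (α - ζ)) ^ n * W) +
          m ^ p * ((2 * C) ^ p * (M₀ * (m : ℝ) ^ α) * ((H : ℝ) ^ (α - ζ)) ^ n * W)) := by
        gcongr
    _ = largeScaleConst p α M₀ C ω m Q * ((H : ℝ) ^ (α - ζ)) ^ n * W := by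
        rw [largeScaleConst]; ring
    _ ≤ largeScaleConst p α M₀ C ω m Q * R ^ (α - ζ) * W := by
        have : 0 ≤ largeScaleConst p α M₀ C ω m Q := by
          rw [largeScaleConst]; positivity
        gcongr

/-! ### Averages and edge energy -/

/-- By Jensen's inequality, `|t - f_B| ^ p` is at most the mean of `|f - t| ^ p`, so any constant
may replace the average. -/
lemma sum_abs_sub_average_rpow_le {p : ℝ} (hp : 1 ≤ p) (B : Finset V) (f : V → ℝ) (t : ℝ) :
    ∑ y ∈ B, |f y - average (B : Set V) f| ^ p ≤ 2 ^ p * 2 * ∑ y ∈ B, |f y - t| ^ p := by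
  have hp0 : 0 < p := by linarith
  rcases B.eq_empty_or_nonempty with rfl | hB
  · simp
  have hc : (0 : ℝ) < B.card := by exact_mod_cast hB.card_pos
  have havg : average (B : Set V) f = (∑ y ∈ B, f y) / B.card := by
    rw [average, Set.ncard_coe_finset, finsum_mem_coe_finset]
  set m := average (B : Set V) f
  have h1 : |t - m| ≤ (∑ y ∈ B, |f y - t|) / B.card := by
    have : t - m = -(∑ y ∈ B, (f y - t)) / B.card := by
      rw [havg, Finset.sum_sub_distrib, Finset.sum_const, nsmul_eq_mul]; field_simp; ring
    rw [this, abs_div, abs_neg, abs_of_pos hc]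
    exact div_le_div_of_nonneg_right (Finset.abs_sum_le_sum_abs _ _) hc.le
  have h2 : B.card * |t - m| ^ p ≤ ∑ y ∈ B, |f y - t| ^ p := by
    have h3 := Real.rpow_le_rpow (abs_nonneg _) h1 hp0.le
    rw [Real.div_rpow (Finset.sum_nonneg fun _ _ => abs_nonneg _) hc.le] at h3
    have h4 := Real.rpow_sum_le_const_mul_sum_rpow B (fun y => f y - t) hp
    have h5 : (B.card : ℝ) ^ p = B.card ^ (p - 1) * B.card := by
      rw [Real.rpow_sub_one hc.ne']; field_simp
    have hcp : (0 : ℝ) < (B.card : ℝ) ^ (p - 1) := Real.rpow_pos_of_pos hc _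
    rw [h5, le_div_iff₀ (by positivity)] at h3
    have h6 := h3.trans h4
    have h7 : (B.card : ℝ) ^ (p - 1) * (B.card * |t - m| ^ p) ≤
        (B.card : ℝ) ^ (p - 1) * ∑ y ∈ B, |f y - t| ^ p := by linarith
    exact le_of_mul_le_mul_left h7 hcp
  calc ∑ y ∈ B, |f y - m| ^ p ≤ ∑ y ∈ B, 2 ^ p * (|f y - t| ^ p + |t - m| ^ p) := by
        refine Finset.sum_le_sum fun y _ => ?_
        exact (Real.rpow_le_rpow (abs_nonneg _) (abs_sub_le _ t _) hp0.le).trans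
          (rpow_add_le_two_rpow_mul hp (abs_nonneg _) (abs_nonneg _))
    _ = 2 ^ p * (∑ y ∈ B, |f y - t| ^ p + B.card * |t - m| ^ p) := by
        rw [← Finset.mul_sum, Finset.sum_add_distrib, Finset.sum_const, nsmul_eq_mul]
    _ ≤ 2 ^ p * (∑ y ∈ B, |f y - t| ^ p + ∑ y ∈ B, |f y - t| ^ p) := by gcongr
    _ = _ := by ring

/-- The `ℓ^p`-norm of the gradient of `f` at a vertex. -/
def vertexGrad (p : ℝ) (nb : V → Finset V) (f : V → ℝ) (v : V) : ℝ :=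
  (∑ w ∈ nb v, |f v - f w| ^ p) ^ (1 / p)

lemma vertexGrad_nonneg (p : ℝ) (nb : V → Finset V) (f : V → ℝ) (v : V) :
    0 ≤ vertexGrad p nb f v :=
  Real.rpow_nonneg (Finset.sum_nonneg fun _ _ => Real.rpow_nonneg (abs_nonneg _) _) _

lemma vertexGrad_rpow {p : ℝ} (hp : 0 < p) (nb : V → Finset V) (f : V → ℝ) (v : V) :
    vertexGrad p nb f v ^ p = ∑ w ∈ nb v, |f v - f w| ^ p := by
  rw [vertexGrad, ← Real.rpow_mul (Finset.sum_nonneg fun _ _ => Real.rpow_nonneg (abs_nonneg _) _),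
    one_div_mul_cancel hp.ne', Real.rpow_one]

lemma abs_sub_le_vertexGrad {p : ℝ} (hp : 0 < p) {nb : V → Finset V} {v w : V} (h : w ∈ nb v) :
    |f v - f w| ≤ vertexGrad p nb f v := by
  rw [← Real.rpow_le_rpow_iff (abs_nonneg _) (vertexGrad_nonneg _ _ _ _) hp, vertexGrad_rpow hp]
  exact Finset.single_le_sum (f := fun w => |f v - f w| ^ p)
    (fun _ _ => Real.rpow_nonneg (abs_nonneg _) _) h

lemma ofReal_sum_vertexGrad_rpow_le {p : ℝ} (hp : 0 < p) {nb : V → Finset V}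
    (hnb : ∀ v w, w ∈ nb v ↔ G.Adj v w) {S : Finset V} {U : Set V}
    (hS : ∀ v ∈ S, v ∈ U ∧ ∀ w, G.Adj v w → w ∈ U) (f : V → ℝ) :
    ENNReal.ofReal (∑ v ∈ S, vertexGrad p nb f v ^ p) ≤ 2 * energy G p U f := by
  classical
  set F : Sym2 V → ℝ≥0∞ := fun e => ENNReal.ofReal (gradLength f e ^ p) with hF
  set P : Finset (Σ _ : V, V) := S.sigma nb
  set q : (Σ _ : V, V) → Sym2 V := fun x => s(x.1, x.2)
  have h1 : ENNReal.ofReal (∑ v ∈ S, vertexGrad p nb f v ^ p) = ∑ x ∈ P, F (q x) := by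
    rw [Finset.sum_sigma, ENNReal.ofReal_sum_of_nonneg fun v _ =>
      Real.rpow_nonneg (vertexGrad_nonneg _ _ _ _) _]
    refine Finset.sum_congr rfl fun v _ => ?_
    rw [vertexGrad_rpow hp, ENNReal.ofReal_sum_of_nonneg fun w _ =>
      Real.rpow_nonneg (abs_nonneg _) _]
    refine Finset.sum_congr rfl fun w _ => ?_
    simp [hF, q, gradLength, abs_sub_comm]
  -- An edge arises from at most its two orientations, whence the factor 2.
  have hfib : ∀ e ∈ P.image q, ((P.filter fun x => q x = e).card : ℝ≥0∞) ≤ 2 := by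
    intro e _
    induction e using Sym2.ind with
    | _ a c =>
      have hsub : (P.filter fun x => q x = s(a, c)) ⊆ {⟨a, c⟩, ⟨c, a⟩} := by
        rintro ⟨x, y⟩ hx
        have h2 := (Finset.mem_filter.1 hx).2
        simp only [q, Sym2.eq_iff] at h2
        rcases h2 with ⟨rfl, rfl⟩ | ⟨rfl, rfl⟩ <;> simp
      exact_mod_cast (Finset.card_le_card hsub).trans Finset.card_le_two
  have himg : ((P.image q : Finset (Sym2 V)) : Set (Sym2 V)) ⊆ edgesIn G U := by
    intro e he
    obtain ⟨⟨v, w⟩, hx, rfl⟩ := Finset.mem_image.1 (Finset.mem_coe.1 he)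
    rw [Finset.mem_sigma] at hx
    have hadj := (hnb _ _).1 hx.2
    refine ⟨hadj, fun y hy => ?_⟩
    rcases Sym2.mem_iff.1 hy with rfl | rfl
    · exact (hS _ hx.1).1
    · exact (hS _ hx.1).2 _ hadj
  rw [h1, Finset.sum_comp F q]
  calc ∑ e ∈ P.image q, (P.filter fun x => q x = e).card • F e
      ≤ ∑ e ∈ P.image q, 2 * F e := by
        refine Finset.sum_le_sum fun e he => ?_
        rw [nsmul_eq_mul]
        exact mul_le_mul_left (hfib e he) _
    _ = 2 * ∑' e : ((P.image q : Finset (Sym2 V)) : Set (Sym2 V)), F e := by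
        rw [← Finset.mul_sum, Finset.tsum_subtype' (P.image q) F]
    _ ≤ 2 * energy G p U f := by
        exact mul_le_mul_right (ENNReal.tsum_mono_subtype F himg) _

/-! ### Choice of constants and conclusion -/

lemma VDGrowth.ncard_ball_le {α CD : ℝ} (h : VDGrowth G α CD) (hG : G.Connected) (x : V) {R : ℝ}
    (hR : 1 ≤ R) : ((ball G x R).ncard : ℝ) ≤ CD ^ 2 * R ^ α := by
  have h1 := h.2 x x 1 R le_rfl hR
  have h2 : ball G x 1 = {x} := by
    ext y
    simp only [ball, Set.mem_ofPred_eq, Set.mem_singleton_iff]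
    rw [← Nat.cast_one, Nat.cast_lt, Nat.lt_one_iff, hG.dist_eq_zero_iff, eq_comm]
  simpa [h2] using h1

/-- After raising to the power `p`, the last condition reads `4 ^ p * 32 ^ ζ ≤ N ^ (1 - ζ)`, which
holds for large `N` because `ζ < 1`. -/
lemma exists_nat_scale {p ζ A : ℝ} (hp : 1 ≤ p) (hζ : ζ < 1) :
    ∃ N : ℕ, 1 ≤ N ∧ A < (32 * N : ℕ) ∧
      4 * ((32 * N : ℕ) : ℝ) ^ (ζ / p) ≤ (N : ℝ) ^ (1 / p) := by
  have hp0 : 0 < p := by linarith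
  have h1 : Filter.Tendsto (fun N : ℕ => (N : ℝ) ^ (1 - ζ)) Filter.atTop Filter.atTop :=
    (tendsto_rpow_atTop (by linarith)).comp tendsto_natCast_atTop_atTop
  obtain ⟨N, ⟨hN1, hN2⟩, hN3⟩ := ((h1.eventually_ge_atTop (4 ^ p * 32 ^ ζ)).and
    (Filter.eventually_ge_atTop 1)).and (Filter.eventually_gt_atTop ⌈A⌉₊) |>.exists
  have hN0 : (0 : ℝ) < N := by exact_mod_cast hN2
  refine ⟨N, hN2, ?_, ?_⟩
  · have h2 : (⌈A⌉₊ : ℝ) < N := by exact_mod_cast hN3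
    have := Nat.le_ceil A
    push_cast; linarith
  · rw [← Real.rpow_le_rpow_iff (by positivity) (by positivity) hp0,
      Real.mul_rpow (by norm_num) (by positivity), ← Real.rpow_mul (by positivity),
      ← Real.rpow_mul (by positivity), one_div_mul_cancel hp0.ne', Real.rpow_one,
      div_mul_cancel₀ _ hp0.ne']
    push_cast
    rw [Real.mul_rpow (by norm_num) hN0.le, ← mul_assoc]
    rw [Real.rpow_sub hN0, Real.rpow_one, le_div_iff₀ (Real.rpow_pos_of_pos hN0 _)] at hN1
    exact hN1

/-- Distance `5 * H ^ (k + 1)` is `5 * H` times the radius `H ^ k`, so `κ = 5 * H` works at all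
scales. `A < H` keeps the radius below the Loewner threshold, and `l` absorbs `L κ + 1`. -/
lemma BallLoewner.hasJumps {p ζ A : ℝ} {c L : ℝ → ℝ} (hp : 1 ≤ p)
    (hBL : BallLoewner G p ζ A c L) (hG : G.Connected)
    (hb : ∀ x n v, v ∈ b x n ↔ G.dist x v < n) (hρ0 : ∀ v, 0 ≤ ρ v)
    (hρ : ∀ v w, G.Adj v w → |f v - f w| ≤ ρ v) {H l : ℕ} (hH : 1 ≤ H) (hA : A < H)
    (hl : L (5 * H) + 1 ≤ (H : ℝ) ^ (l + 1)) :
    HasJumps G f ρ b p H l ((2 / c (5 * H)) ^ (1 / p)) ((H : ℝ) ^ (ζ / p)) := by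
  have hp0 : 0 < p := by linarith
  have hH0 : (0 : ℝ) < H := by exact_mod_cast hH
  have hc : 0 < c (5 * H) := (hBL.2 (5 * H) (by positivity)).1
  intro k x₁ x₂ u v X hx huv hX hW
  have hg : ∀ v, 0 ≤ ρ v ^ p := fun v => Real.rpow_nonneg (hρ0 v) p
  have hHk : (0 : ℝ) < (H : ℝ) ^ k := by positivity
  obtain ⟨θ, h1, h2, -, h4⟩ := hBL.exists_path hp hG hb hρ0 (κ := 5 * H) (by positivity)
    (n := H ^ k) (m := H ^ (k + 1 + l)) (x₁ := x₁) (x₂ := x₂) (u := u) (v := v)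
    (Nat.one_le_pow _ _ hH) (by
      have : (G.dist x₁ x₂ : ℝ) ≤ 5 * (H : ℝ) ^ (k + 1) := by exact_mod_cast hx
      rw [pow_succ] at this
      push_cast; linarith) (by
      have : (H : ℝ) ^ (k + 1) ≤ G.dist u v := by exact_mod_cast huv
      rw [pow_succ] at this
      push_cast
      nlinarith) (by
      push_cast
      rw [show k + 1 + l = (l + 1) + k by omega, pow_add _ (l + 1)]
      exact mul_le_mul_of_nonneg_right hl hHk.le)
  refine ⟨θ.verts, θ.walkConnected, ⟨_, θ.first_mem, h1⟩, ⟨_, θ.last_mem, h2⟩, ?_⟩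
  intro s hs t ht
  refine (θ.abs_sub_le_sum hρ0 hρ hs ht).trans (h4.trans ?_)
  have hHζ : (0 : ℝ) < ((H ^ k : ℕ) : ℝ) ^ ζ := Real.rpow_pos_of_pos (by positivity) _
  have hle : 2 * (∑ x ∈ b x₁ (H ^ (k + 1 + l)), ρ x ^ p) / (c (5 * H) * ((H ^ k : ℕ) : ℝ) ^ ζ) ≤
      2 / c (5 * H) * (X ^ p / ((H ^ k : ℕ) : ℝ) ^ ζ) := by
    rw [div_mul_div_comm]
    gcongr
  refine (Real.rpow_le_rpow (div_nonneg (mul_nonneg (by norm_num)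
    (Finset.sum_nonneg fun v _ => hg v)) (by positivity)) hle (by positivity)).trans (le_of_eq ?_)
  rw [Real.mul_rpow (by positivity) (by positivity),
    Real.div_rpow (by positivity) hHζ.le, ← Real.rpow_mul hX, mul_one_div_cancel hp0.ne',
    Real.rpow_one, ← Real.rpow_mul (by positivity), mul_one_div, mul_div_assoc]
  congr 2
  push_cast
  rw [← Real.rpow_natCast, ← Real.rpow_natCast, ← Real.rpow_mul hH0.le, ← Real.rpow_mul hH0.le,
    mul_comm]

/-- The volume growth and ball Loewner conditions bound the deviation of `f` from some constant on
a ball whose radius does not exceed the diameter by more than one. -/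
theorem exists_sum_abs_sub_rpow_le {p α ζ A CD : ℝ} {c L : ℝ → ℝ} (hp : 1 ≤ p) (hα : 1 ≤ α)
    (hζ : ζ < 1) (hVD : VDGrowth G α CD) (hBL : BallLoewner G p ζ A c L) (hG : G.Connected)
    (hb : ∀ x n v, v ∈ b x n ↔ G.dist x v < n) (hρ0 : ∀ v, 0 ≤ ρ v)
    (hρ : ∀ v w, G.Adj v w → |f v - f w| ≤ ρ v)
    {N l H Q : ℕ} {J η K C ω R₀ R : ℝ} (hN : 1 ≤ N) (hH : H = 32 * N) (hA : A < H)
    (hη : η = (H : ℝ) ^ (ζ / p)) (hN' : 4 * η ≤ (N : ℝ) ^ (1 / p))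
    (hl : L (5 * H) + 1 ≤ (H : ℝ) ^ (l + 1)) (hQ : Q = 17 * H ^ (l + 1))
    (hJ : J = (2 / c (5 * H)) ^ (1 / p)) (hK : K = max 3 (J * ((N : ℝ) ^ (1 / p)) ^ (l + 1)))
    (hC : C = J + K + K / η) (hω : ω = (H : ℝ) ^ ((α - ζ) / 2)) (hR₀ : R₀ = Q + 1)
    (hR : 1 ≤ R) {x u v : V} (huv : R ≤ G.dist u v + 1) {B S : Finset V}
    (hB : ∀ v, v ∈ B ↔ (G.dist x v : ℝ) < R) (hS : ∀ v, (G.dist x v : ℝ) < 2 * R - 1 → v ∈ S) :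
    ∃ t : ℝ, ∑ y ∈ B, |f y - t| ^ p ≤
      (CD ^ 2 * R₀ ^ α * R₀ ^ p + largeScaleConst p α (CD ^ 2) C ω (2 * Q * H) Q) *
        R ^ (α - ζ) * ∑ v ∈ S, ρ v ^ p := by
  have hp0 : 0 < p := by linarith
  have hβ : 0 < α - ζ := by linarith
  have hH32 : 32 ≤ H := by omega
  have hH0 : (0 : ℝ) < H := by exact_mod_cast (by omega : 0 < H)
  have hH1 : (1 : ℝ) < H := by exact_mod_cast (by omega : 1 < H)
  have hη0 : 0 < η := hη ▸ Real.rpow_pos_of_pos hH0 _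
  have hc : 0 < c (5 * H) := (hBL.2 (5 * H) (by positivity)).1
  have hJ0 : 0 ≤ J := by rw [hJ]; positivity
  have hK3 : 3 ≤ K := hK ▸ le_max_left _ _
  have hKJ : J * ((N : ℝ) ^ (1 / p)) ^ (l + 1) ≤ K := hK ▸ le_max_right _ _
  have hC0 : 0 ≤ C := by rw [hC]; positivity
  have hω1 : 1 < ω := hω ▸ Real.one_lt_rpow hH1 (by positivity)
  have hω2 : ω * ω = (H : ℝ) ^ (α - ζ) := by
    rw [hω, ← Real.rpow_add hH0]; congr 1; ring
  have hηp : η ^ p = (H : ℝ) ^ ζ := by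
    rw [hη, ← Real.rpow_mul hH0.le, div_mul_cancel₀ _ hp0.ne']
  have hW0 : 0 ≤ ∑ v ∈ S, ρ v ^ p := Finset.sum_nonneg fun v _ => Real.rpow_nonneg (hρ0 v) p
  have hRβ : 0 ≤ R ^ (α - ζ) := Real.rpow_nonneg (by linarith) _
  have hQ1 : 1 ≤ Q := by rw [hQ]; have := Nat.one_le_pow (l + 1) H (by omega); omega
  have hQ0 : (0 : ℝ) < Q := by exact_mod_cast hQ1
  have hcardB : (B.card : ℝ) ≤ CD ^ 2 * R ^ α := by
    have h1 : (B : Set V) = ball G x R := by ext v; simp [hB, ball]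
    rw [← Set.ncard_coe_finset, h1]
    exact hVD.ncard_ball_le hG x hR
  have hcard : ∀ v k, ((b v (Q * H ^ k)).card : ℝ) ≤ CD ^ 2 * ((Q * H ^ k : ℕ) : ℝ) ^ α := by
    intro v k
    have h1 : (b v (Q * H ^ k) : Set V) = ball G v (Q * H ^ k : ℕ) := by
      ext w
      rw [Finset.mem_coe, hb]
      simp only [ball, Set.mem_ofPred_eq, Nat.cast_lt]
    rw [← Set.ncard_coe_finset, h1]
    refine hVD.ncard_ball_le hG v ?_
    exact_mod_cast Nat.mul_pos hQ1 (Nat.one_le_pow k H (by omega))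
  have hsmall0 : 0 ≤ CD ^ 2 * R₀ ^ α * R₀ ^ p := by rw [hR₀]; positivity
  have hlarge0 : 0 ≤ largeScaleConst p α (CD ^ 2) C ω (2 * Q * H) Q := by
    have h1 : 0 ≤ ω / (ω - 1) := div_nonneg (by linarith) (by linarith)
    have h2 : 0 ≤ ω ^ (1 / p) / (ω ^ (1 / p) - 1) := div_nonneg (by positivity)
      (by have := Real.one_lt_rpow hω1 (z := 1 / p) (by positivity); linarith)
    rw [largeScaleConst]; positivity
  rcases le_or_gt R R₀ with hRR | hRR
  · refine ⟨f x, (sum_abs_sub_rpow_le_of_bounded_radius hG hρ0 hρ hp hβ.le (by linarith)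
      (sq_nonneg CD) hR hRR (fun v hv => (hB v).1 hv) (fun v hv => hS v (by linarith))
      hcardB).trans ?_⟩
    gcongr
    linarith
  · obtain ⟨n, hn1, hn2⟩ := exists_nat_pow_near (x := (R - 1) / Q) (y := (H : ℝ))
      (by rw [one_le_div hQ0]; linarith) hH1
    rw [le_div_iff₀ hQ0] at hn1
    rw [div_lt_iff₀ hQ0] at hn2
    have hRn : (Q * H ^ n : ℕ) + 1 ≤ R := by push_cast; linarith
    have hRm : R ≤ (2 * Q * H * H ^ n : ℕ) := by
      have h1 : 1 ≤ Q * H * H ^ n := Nat.mul_pos (Nat.mul_pos hQ1 (by omega))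
        (Nat.one_le_pow n H (by omega))
      have h2 : (1 : ℝ) ≤ Q * H * (H : ℝ) ^ n := by exact_mod_cast h1
      rw [pow_succ] at hn2
      push_cast; linarith
    -- `u` and `v` are at least `17 * H ^ (n + 1)` apart, so no `y` is within `3 * H ^ (n + 1)` of
    -- both.
    have hfar : ∀ y, ∀ k ≤ n, ∃ z, H ^ (k + 1) + 2 * H ^ k ≤ G.dist y z := by
      intro y k hk
      have h1 : Q * H ^ n ≤ G.dist u v := by
        have : ((Q * H ^ n : ℕ) : ℝ) ≤ G.dist u v := by linarith
        exact_mod_cast this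
      have h2 := hG.dist_triangle (u := u) (v := y) (w := v)
      rw [G.dist_comm (u := u) (v := y)] at h2
      have h3 : H ^ (k + 1) ≤ H ^ (n + 1) := Nat.pow_le_pow_right (by omega) (by omega)
      have h4 : H ^ k ≤ H ^ (n + 1) := Nat.pow_le_pow_right (by omega) (by omega)
      have h5 : 17 * H ^ (n + 1) ≤ Q * H ^ n := by
        rw [hQ, mul_assoc, ← pow_add]
        exact Nat.mul_le_mul_left _ (Nat.pow_le_pow_right (by omega) (by omega))
      by_contra! hcon
      have h6 := hcon u
      have h7 := hcon v
      omega
    obtain ⟨a, ha0, ha, han⟩ := exists_approximation hG hb hρ0 hρ hp hN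
      (hH ▸ hJ ▸ hη ▸ hBL.hasJumps hp hG hb hρ0 hρ (by omega) hA hl) hη0
      (Real.one_le_rpow (by exact_mod_cast hN) (by positivity))
      (by rw [← Real.rpow_mul (by positivity), one_div_mul_cancel hp0.ne', Real.rpow_one])
      hN' hK3 (by linarith) hH hQ
      (Far := fun k x => ∃ y, H ^ (k + 1) + 2 * H ^ k ≤ G.dist x y) (fun _ _ => Iff.rfl)
      (X := fun k x => (∑ v ∈ b x (Q * H ^ k), ρ v ^ p) ^ (1 / p)) (fun _ _ => rfl)
    rw [← hC] at ha han
    refine ⟨a n x, (sum_abs_sub_rpow_le_of_approximation hG hb hρ0 hp (by linarith)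
      (sq_nonneg CD) hC0 hη0 (by omega) hηp hω1 hω2 hβ.le hQ1 hRn hRm (fun _ _ => rfl)
      hB hS hcard hcardB (fun y _ => ha0 y (hfar y 0 (by omega)))
      (fun y _ k hk => ha k y (hfar y (k + 1) hk))
      (fun y _ z _ hyz => han n y z (hfar y n le_rfl) (hfar z n le_rfl) hyz)).trans ?_⟩
    gcongr
    linarith

/-- Every ball of radius at least one is a ball whose radius does not exceed the diameter by more
than one. -/
lemma exists_radius_le (G : SimpleGraph V) (x : V) {R : ℝ} (hR : 1 ≤ R) :
    ∃ R' u v, 1 ≤ R' ∧ R' ≤ R ∧ R' ≤ (G.dist u v : ℝ) + 1 ∧ ball G x R' = ball G x R ∧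
      ball G x (2 * R') = ball G x (2 * R) := by
  by_cases h : ∃ u v, R ≤ (G.dist u v : ℝ) + 1
  · obtain ⟨u, v, huv⟩ := h
    exact ⟨R, u, v, hR, le_rfl, huv, rfl, rfl⟩
  push Not at h
  set T : Set ℕ := {n | ∃ u v, G.dist u v = n}
  have hne : T.Nonempty := ⟨_, x, x, rfl⟩
  have hbdd : BddAbove T := by
    refine ⟨⌈R⌉₊, ?_⟩
    rintro n ⟨u, v, rfl⟩
    have h1 := h u v
    have h2 := Nat.le_ceil R
    exact_mod_cast (by linarith : (G.dist u v : ℝ) ≤ ⌈R⌉₊)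
  obtain ⟨u, v, huv⟩ := Nat.sSup_mem hne hbdd
  have hmax : ∀ y z, (G.dist y z : ℝ) ≤ G.dist u v := fun y z => by
    rw [huv]; exact_mod_cast le_csSup hbdd ⟨y, z, rfl⟩
  have h0 : (0 : ℝ) ≤ G.dist u v := by positivity
  have huniv : ∀ r, (G.dist u v : ℝ) + 1 ≤ r → ball G x r = Set.univ := fun r hr =>
    Set.eq_univ_of_forall fun y => by
      have := hmax x y
      change (G.dist x y : ℝ) < r
      linarith
  have h1 := h u v
  -- Balls are open, so radius diameter plus one already gives the whole graph.
  refine ⟨G.dist u v + 1, u, v, by linarith, h1.le, le_rfl, ?_, ?_⟩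
  · rw [huniv _ le_rfl, huniv _ h1.le]
  · rw [huniv _ (by linarith), huniv _ (by linarith)]

end DiscretePI

end

/-- The constant `C_PI` depends only on `p`, `α`, `ζ` and the constants of the two hypotheses, and
not on the graph. -/
theorem theorem4p2 (p α ζ : ℝ) (hp : 1 ≤ p) (hα : 1 ≤ α) (hζ : 1 - p ≤ ζ) (hζ' : ζ < 1)
    (CD A : ℝ) (c L : ℝ → ℝ) :
    ∃ CPI : ℝ, ∀ (V : Type u) (G : SimpleGraph V),
      G.Connected → (∀ v : V, (G.neighborSet v).Finite) →
      DiscretePI.VDGrowth G α CD →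
      DiscretePI.BallLoewner G p ζ A c L →
      DiscretePI.Poincare G p (α - ζ) CPI 2 := by
  have hp0 : 0 < p := by linarith
  obtain ⟨N, hN, hA, hN'⟩ := DiscretePI.exists_nat_scale (A := A) hp hζ'
  obtain ⟨H, hH⟩ : ∃ H : ℕ, H = 32 * N := ⟨_, rfl⟩
  rw [← hH] at hA hN'
  obtain ⟨l, hl⟩ : ∃ l : ℕ, L (5 * H) + 1 ≤ (H : ℝ) ^ (l + 1) := by
    have hH1 : (1 : ℝ) < H := by exact_mod_cast (by omega : 1 < H)
    obtain ⟨l, hl⟩ := pow_unbounded_of_one_lt (L (5 * H) + 1) hH1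
    exact ⟨l, hl.le.trans (pow_le_pow_right₀ hH1.le (by omega))⟩
  obtain ⟨Q, hQ⟩ : ∃ Q : ℕ, Q = 17 * H ^ (l + 1) := ⟨_, rfl⟩
  obtain ⟨η, hη⟩ : ∃ η : ℝ, η = (H : ℝ) ^ (ζ / p) := ⟨_, rfl⟩
  obtain ⟨J, hJ⟩ : ∃ J : ℝ, J = (2 / c (5 * H)) ^ (1 / p) := ⟨_, rfl⟩
  obtain ⟨K, hK⟩ : ∃ K : ℝ, K = max 3 (J * ((N : ℝ) ^ (1 / p)) ^ (l + 1)) := ⟨_, rfl⟩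
  obtain ⟨C, hC⟩ : ∃ C : ℝ, C = J + K + K / η := ⟨_, rfl⟩
  obtain ⟨ω, hω⟩ : ∃ ω : ℝ, ω = (H : ℝ) ^ ((α - ζ) / 2) := ⟨_, rfl⟩
  obtain ⟨R₀, hR₀⟩ : ∃ R₀ : ℝ, R₀ = (Q : ℝ) + 1 := ⟨_, rfl⟩
  obtain ⟨M, hM⟩ : ∃ M : ℝ, M = CD ^ 2 * R₀ ^ α * R₀ ^ p +
    DiscretePI.largeScaleConst p α (CD ^ 2) C ω (2 * Q * H) Q := ⟨_, rfl⟩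
  rw [← hη] at hN'
  refine ⟨max 1 (2 ^ p * 2 * M * 2), fun V G hG hf hVD hBL => ⟨le_max_left _ _, by norm_num,
    fun x R f hR => ?_⟩⟩
  classical
  have hfin := DiscretePI.finite_ball hG hf
  set nb : V → Finset V := fun v => (hf v).toFinset with hnb
  have hnb' : ∀ v w, w ∈ nb v ↔ G.Adj v w := fun v w => by simp [hnb]
  obtain ⟨R', u, v, hR'1, hR'R, huv, hball, hball2⟩ := DiscretePI.exists_radius_le G x hR
  rw [← hball, ← hball2]
  set B := (hfin x R').toFinset with hB
  have hBc : (B : Set V) = DiscretePI.ball G x R' := by simp [hB]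
  -- Radius `2 * R' - 1` ensures that edges at vertices of `S` have both ends in the ball of radius
  -- `2 * R'`.
  set S := (hfin x (2 * R' - 1)).toFinset with hS
  set W := ∑ v ∈ S, DiscretePI.vertexGrad p nb f v ^ p with hW
  obtain ⟨t, ht⟩ := DiscretePI.exists_sum_abs_sub_rpow_le (f := f)
    (ρ := DiscretePI.vertexGrad p nb f)
    (b := fun x n => (hfin x n).toFinset) hp hα hζ' hVD hBL hG
    (fun x n v => by simp [DiscretePI.ball]) (DiscretePI.vertexGrad_nonneg p nb f)
    (fun v w hvw => DiscretePI.abs_sub_le_vertexGrad hp0 ((hnb' v w).2 hvw)) hN hH hA hη hN' hl hQ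
    hJ hK hC hω hR₀ hR'1 huv (x := x) (B := B) (S := S)
    (fun v => by simp [hB, DiscretePI.ball]) (fun v hv => by simpa [hS, DiscretePI.ball] using hv)
  rw [← hM] at ht
  have hE : ENNReal.ofReal W ≤ 2 * DiscretePI.energy G p (DiscretePI.ball G x (2 * R')) f := by
    refine DiscretePI.ofReal_sum_vertexGrad_rpow_le hp0 hnb' (fun v hv => ?_) f
    have hv' : (G.dist x v : ℝ) < 2 * R' - 1 := by simpa [hS, DiscretePI.ball] using hv
    refine ⟨show (G.dist x v : ℝ) < 2 * R' by linarith, fun w hvw => ?_⟩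
    have h1 : (G.dist x w : ℝ) ≤ G.dist x v + 1 := by
      exact_mod_cast DiscretePI.dist_le_dist_add_one hG x v w hvw
    exact show (G.dist x w : ℝ) < 2 * R' by linarith
  have hW0 : 0 ≤ W := Finset.sum_nonneg fun v _ =>
    Real.rpow_nonneg (DiscretePI.vertexGrad_nonneg _ _ _ _) _
  have hRR : R' ^ (α - ζ) ≤ R ^ (α - ζ) :=
    Real.rpow_le_rpow (by linarith) hR'R (by linarith)
  have hR'0 : 0 ≤ R' ^ (α - ζ) := Real.rpow_nonneg (by linarith) _
  have hsum : ∑ᶠ y ∈ DiscretePI.ball G x R',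
      |f y - DiscretePI.average (DiscretePI.ball G x R') f| ^ p ≤
      max 1 (2 ^ p * 2 * M * 2) / 2 * R ^ (α - ζ) * W := by
    rw [← hBc, finsum_mem_coe_finset]
    calc _ ≤ 2 ^ p * 2 * ∑ y ∈ B, |f y - t| ^ p :=
          DiscretePI.sum_abs_sub_average_rpow_le hp B f t
      _ ≤ 2 ^ p * 2 * (M * R' ^ (α - ζ) * W) :=
          mul_le_mul_of_nonneg_left ht (by positivity)
      _ = (2 ^ p * 2 * M * 2) / 2 * R' ^ (α - ζ) * W := by ring
      _ ≤ max 1 (2 ^ p * 2 * M * 2) / 2 * R ^ (α - ζ) * W := by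
          gcongr
          exact le_max_right _ _
  have hmax : 0 ≤ max 1 (2 ^ p * 2 * M * 2) := zero_le_one.trans (le_max_left _ _)
  have hRβ : 0 ≤ R ^ (α - ζ) := hR'0.trans hRR
  calc ENNReal.ofReal _
      ≤ ENNReal.ofReal (max 1 (2 ^ p * 2 * M * 2) / 2 * R ^ (α - ζ) * W) :=
        ENNReal.ofReal_le_ofReal hsum
    _ = ENNReal.ofReal (max 1 (2 ^ p * 2 * M * 2) / 2 * R ^ (α - ζ)) * ENNReal.ofReal W :=
        ENNReal.ofReal_mul (by positivity)
    _ ≤ ENNReal.ofReal (max 1 (2 ^ p * 2 * M * 2) / 2 * R ^ (α - ζ)) *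
          (2 * DiscretePI.energy G p (DiscretePI.ball G x (2 * R')) f) :=
        mul_le_mul_right hE _
    _ = ENNReal.ofReal (max 1 (2 ^ p * 2 * M * 2) * R ^ (α - ζ)) *
          DiscretePI.energy G p (DiscretePI.ball G x (2 * R')) f := by
        rw [← mul_assoc, ← ENNReal.ofReal_ofNat 2, ← ENNReal.ofReal_mul (by positivity)]
        congr 2; ring
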